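/- Logarithms and $\exp$ are to base $2$, $\exp(x)=2^x$. Let $\mathcal H=\mathbb C^d$, let $\rho>0$ be a density operator on $\mathcal H$ with full support, and let $\mathbf a=(a_j)_{j=1,\dots,m}$ be a POVM on $\mathcal H$, that is, $a_j\ge 0$ and $\sum_j a_j=\mathbb 1$. Put $\lambda_j=\operatorname{Tr}(\rho a_j)$, $\hat\rho_j=\lambda_j^{-1}\sqrt\rho\,a_j\sqrt\rho$ (terms with $\lambda_j=0$ do not contribute below), and let $H(\sigma)=-\operatorname{Tr}\sigma\log\sigma$ be the von Neumann entropy. Let $(\nu_l)_{l\ge 0}$ be nonnegative integers with $\nu_l=o(l)$ as $l\to\infty$, and let $\epsilon>0$. Then there is a function $f(l)=o(l)$ such that for every $l$ there exist a number $M$ with $$M\le \exp\Big(l\Big(H(\rho)-\sum_j\lambda_jH(\hat\rho_j)\Big)+f(l)\Big),$$ a POVM $(A_\mu)_{\mu=1,\dots,M}$ on $\mathcal H^{\otimes l}$, and labels $j_\mu=(j_{\mu 1},\dots,j_{\mu l})\in\{1,\dots,m\}^l$ for $\mu=1,\dots,M$, such that $$\sum_{K\subset\{1,\dots,l\},\ |K|\le\nu_l}\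 \ \sum_{j^K\in\{1,\dots,m\}^K}\big\|A^{(K)}_{j^K}-a_{j^K}\big\|\le\epsilon .$$ Here $\|\cdot\|$ is the operator norm, $a_{j^K}=\bigotimes_{k\in K}a_{j_k}$, and $$A^{(K)}_{j^K}=\operatorname{Tr}_{[l]\setminus K}\Big(\big(\rho^{\otimes[l]\setminus K}\otimes\mathbb 1^{\otimes K}\big)\sum_{\mu:\ \forall k\in K\ j_{\mu k}=j_k}A_\mu\Big)$$ is the restriction of the labelled POVM to the tensor factors in $K$, where $[l]=\{1,\dots,l\}$. -/

import Mathlib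

open scoped ComplexOrder Matrix.Norms.L2Operator

noncomputable section

namespace QMeas

/-- `a` is a POVM: positive semidefinite operators that sum to the identity. -/
def IsPOVM {ι n : Type*} [Fintype ι] [Fintype n] [DecidableEq n]
    (a : ι → Matrix n n ℂ) : Prop :=
  (∀ i, (a i).PosSemidef) ∧ ∑ i, a i = 1

/-- Von Neumann entropy to base `2`, `-Tr(A log₂ A)` (with `0 log 0 = 0`), for Hermitian `A`. -/
def entropy {n : Type*} [Fintype n] [DecidableEq n] (A : Matrix n n ℂ) : ℝ :=
  (Matrix.trace (cfc Real.negMulLog A)).re / Real.log 2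

/-- The probability `λ = Tr(ρ a)` of an outcome with operator `a` in the state `ρ`. -/
def prob {d : ℕ} (ρ a : Matrix (Fin d) (Fin d) ℂ) : ℝ :=
  (Matrix.trace (ρ * a)).re

/-- The state `√ρ a √ρ / Tr(ρ a)` of the canonical ensemble; it is `0` when `Tr(ρ a) = 0`. -/
def canonicalState {d : ℕ} (ρ a : Matrix (Fin d) (Fin d) ℂ) : Matrix (Fin d) (Fin d) ℂ :=
  (((prob ρ a)⁻¹ : ℝ) : ℂ) • (cfc Real.sqrt ρ * a * cfc Real.sqrt ρ)

/-- The entropy defect `H(ρ) - ∑ⱼ λⱼ H(ρ̂ⱼ)`. -/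
def entropyDefect {d m : ℕ} (ρ : Matrix (Fin d) (Fin d) ℂ)
    (a : Fin m → Matrix (Fin d) (Fin d) ℂ) : ℝ :=
  entropy ρ - ∑ j, prob ρ (a j) * entropy (canonicalState ρ (a j))

/-- The tensor product `⨂ₖ B k` as an operator on `⨂ₖ ℂᵈ`, in the product basis, which is indexed
by the functions `κ → Fin d`. -/
def tensorProd {κ : Type*} [Fintype κ] {d : ℕ} (B : κ → Matrix (Fin d) (Fin d) ℂ) :
    Matrix (κ → Fin d) (κ → Fin d) ℂ :=
  Matrix.of fun x y => ∏ k, B k (x k) (y k)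

/-- The product basis vector of `(ℂᵈ)^{⊗l}` with labels `x` on the factors in `K` and `z` on the
others. -/
def glue {l d : ℕ} (K : Finset (Fin l)) (x : K → Fin d) (z : {k : Fin l // k ∉ K} → Fin d) :
    Fin l → Fin d :=
  fun k => if h : k ∈ K then x ⟨k, h⟩ else z ⟨k, h⟩

/-- The partial trace over the tensor factors outside `K`. -/
def partialTrace {l d : ℕ} (K : Finset (Fin l))
    (X : Matrix (Fin l → Fin d) (Fin l → Fin d) ℂ) : Matrix (K → Fin d) (K → Fin d) ℂ :=
  Matrix.of fun x y => ∑ z : {k : Fin l // k ∉ K} → Fin d, X (glue K x z) (glue K y z)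

/-- The element `A^{(K)}_{j^K}` of the restriction to the factors in `K` of a family of operators
`A μ` on `(ℂᵈ)^{⊗l}` whose outcome `μ` is labelled by the tuple `J μ`:
`Tr_{[l]∖K} ((ρ^{⊗[l]∖K} ⊗ 1^{⊗K}) ∑_{μ : ∀ k ∈ K, J μ k = j k} A μ)`. -/
def restriction {ι : Type*} [Fintype ι] {l d m : ℕ} (ρ : Matrix (Fin d) (Fin d) ℂ)
    (J : ι → Fin l → Fin m) (A : ι → Matrix (Fin l → Fin d) (Fin l → Fin d) ℂ)
    (K : Finset (Fin l)) (j : K → Fin m) : Matrix (K → Fin d) (K → Fin d) ℂ :=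
  partialTrace K
    (tensorProd (fun k => if k ∈ K then 1 else ρ) *
      ∑ μ with ∀ k : K, J μ k = j k, A μ)

/-- The total deviation of the restrictions of the labelled family `A` to all sets `K` of at most
`ν` factors from the product POVMs `a^{⊗K}`, in operator norm. -/
def restrictionError {ι : Type*} [Fintype ι] {l d m : ℕ} (ρ : Matrix (Fin d) (Fin d) ℂ)
    (a : Fin m → Matrix (Fin d) (Fin d) ℂ) (ν : ℕ)
    (J : ι → Fin l → Fin m) (A : ι → Matrix (Fin l → Fin d) (Fin l → Fin d) ℂ) : ℝ :=
  ∑ K : Finset (Fin l) with K.card ≤ ν, ∑ j : K → Fin m,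
    ‖restriction ρ J A K j - tensorProd (fun k : K => a (j k))‖

end QMeas

end

/-!
Draw `N` sequences `J` of outcomes independently from the product distribution of the `λⱼ`. The
operators `√ρ^{⊗l} a_J √ρ^{⊗l}`, normalized in trace, cut off to the typical eigenvalues of `ρ̂_J`
and compressed to the typical subspace of `ρ^{⊗l}`, have squared Hilbert–Schmidt norm at most about
`2 ^ (-l ∑ⱼ λⱼ H(ρ̂ⱼ))` and live on a subspace of dimension about `2 ^ (l H(ρ))`. Once `N` exceeds
the product of these two numbers by a factor `2 ^ (δ l)`, a second-moment estimate shows that some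
sample approximates all the marginal sums at once, in trace norm and up to an exponentially small
error.

Conjugation by the inverse square root of their sum turns the sampled operators into a POVM, and the
Powers–Størmer inequality bounds the error made by replacing this square root by `√ρ^{⊗l}`. The
partial trace contracts the trace norm, and the passage from the trace norm weighted by `√ρ` to the
operator norm costs a factor `‖ρ⁻¹‖ ^ ν_l = 2 ^ o(l)`, which the exponentially small error absorbs.
-/

noncomputable section

namespace QMeas

open Matrix

section HilbertSchmidt

variable {l m n : Type*} [Fintype l] [Fintype m] [Fintype n]

/-- The squared Hilbert–Schmidt norm. It is a function of its own because matrices carry the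
operator norm throughout. -/
def hsSq (X : Matrix m n ℂ) : ℝ := ∑ i, ∑ j, ‖X i j‖ ^ 2

lemma hsSq_nonneg (X : Matrix m n ℂ) : 0 ≤ hsSq X :=
  Finset.sum_nonneg fun _ _ => Finset.sum_nonneg fun _ _ => by positivity

lemma hsSq_conjTranspose (X : Matrix m n ℂ) : hsSq Xᴴ = hsSq X := by
  simp only [hsSq, conjTranspose_apply, norm_star]
  exact Finset.sum_comm

lemma trace_conjTranspose_mul_self (X : Matrix m n ℂ) : (Xᴴ * X).trace = hsSq X := by
  simp only [hsSq, trace, diag, mul_apply, conjTranspose_apply, Complex.ofReal_sum,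
    Complex.ofReal_pow, Complex.star_def, Complex.conj_mul']
  exact Finset.sum_comm

lemma hsSq_smul (c : ℝ) (X : Matrix m n ℂ) : hsSq (c • X) = c ^ 2 * hsSq X := by
  simp only [hsSq, Matrix.smul_apply, norm_smul, mul_pow, Real.norm_eq_abs, sq_abs, Finset.mul_sum]

lemma hsSq_of_isStarProjection {Q : Matrix n n ℂ} (hQ : IsStarProjection Q) :
    hsSq Q = Q.trace.re := by
  have h := trace_conjTranspose_mul_self Q
  rw [← star_eq_conjTranspose, hQ.isSelfAdjoint.star_eq, hQ.isIdempotentElem.eq] at h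
  rw [h, Complex.ofReal_re]

lemma norm_trace_mul_le (X : Matrix m n ℂ) (Y : Matrix n m ℂ) :
    ‖(X * Y).trace‖ ≤ √(hsSq X) * √(hsSq Y) := by
  rw [← hsSq_conjTranspose Y]
  simp only [hsSq, trace, diag, mul_apply, ← Fintype.sum_prod_type', conjTranspose_apply, norm_star]
  calc ‖∑ p : m × n, X p.1 p.2 * Y p.2 p.1‖ ≤ ∑ p : m × n, ‖X p.1 p.2‖ * ‖Y p.2 p.1‖ :=
        norm_sum_le_of_le _ fun p _ => norm_mul_le _ _
    _ ≤ _ := Real.sum_mul_le_sqrt_mul_sqrt _ _ _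

lemma hsSq_mul_le_norm_sq_mul [DecidableEq m] (W : Matrix l m ℂ) (X : Matrix m n ℂ) :
    hsSq (W * X) ≤ ‖W‖ ^ 2 * hsSq X := by
  have hcol (j : n) : ∑ i, ‖(W * X) i j‖ ^ 2 ≤ ‖W‖ ^ 2 * ∑ i, ‖X i j‖ ^ 2 := by
    have h := pow_le_pow_left₀ (norm_nonneg _) (l2_opNorm_mulVec W (WithLp.toLp 2 (X.col j))) 2
    rw [mul_pow, EuclideanSpace.norm_sq_eq, EuclideanSpace.norm_sq_eq] at h
    exact h
  rw [hsSq, hsSq, Finset.sum_comm, Finset.sum_comm (f := fun i j => ‖X i j‖ ^ 2), Finset.mul_sum]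
  exact Finset.sum_le_sum fun j _ => hcol j

lemma hsSq_mul_le_mul_norm_sq [DecidableEq n] (X : Matrix l m ℂ) (W : Matrix m n ℂ) :
    hsSq (X * W) ≤ hsSq X * ‖W‖ ^ 2 := by
  classical
  rw [← hsSq_conjTranspose, ← hsSq_conjTranspose X, conjTranspose_mul, mul_comm,
    ← l2_opNorm_conjTranspose]
  exact hsSq_mul_le_norm_sq_mul _ _

lemma hsSq_mul_le_of_norm_le_one [DecidableEq n] {W : Matrix m n ℂ} (hW : ‖W‖ ≤ 1)
    (X : Matrix l m ℂ) :
    hsSq (X * W) ≤ hsSq X :=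
  (hsSq_mul_le_mul_norm_sq X W).trans
    (mul_le_of_le_one_right (hsSq_nonneg X) (pow_le_one₀ (norm_nonneg _) hW))

lemma hsSq_mul_le_of_norm_le_one' [DecidableEq m] {W : Matrix l m ℂ} (hW : ‖W‖ ≤ 1)
    (X : Matrix m n ℂ) :
    hsSq (W * X) ≤ hsSq X :=
  (hsSq_mul_le_norm_sq_mul W X).trans
    (mul_le_of_le_one_left (hsSq_nonneg X) (pow_le_one₀ (norm_nonneg _) hW))

end HilbertSchmidt

section ConjDiag

variable {n : Type*} [Fintype n] [DecidableEq n]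

/-- The Hermitian matrix `U diag(f) U*` with real eigenvalues `f` in the orthonormal basis given by
the columns of `U`. -/
def conjDiag (U : unitaryGroup n ℂ) (f : n → ℝ) : Matrix n n ℂ :=
  Unitary.conjStarAlgAut ℂ _ U (diagonal (RCLike.ofReal ∘ f))

lemma eq_conjDiag_eigenvalues {A : Matrix n n ℂ} (hA : A.IsHermitian) :
    A = conjDiag hA.eigenvectorUnitary hA.eigenvalues :=
  hA.spectral_theorem

lemma cfc_eq_conjDiag {A : Matrix n n ℂ} (hA : A.IsHermitian) (f : ℝ → ℝ) :
    cfc f A = conjDiag hA.eigenvectorUnitary (f ∘ hA.eigenvalues) :=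
  hA.cfc_eq f

variable (U : unitaryGroup n ℂ) (f g : n → ℝ)

lemma conjDiag_one : conjDiag U 1 = 1 := by
  rw [conjDiag, ← map_one (Unitary.conjStarAlgAut ℂ _ U), ← diagonal_one]
  congr 2

lemma conjDiag_add : conjDiag U (f + g) = conjDiag U f + conjDiag U g := by
  rw [conjDiag, conjDiag, conjDiag, ← map_add, diagonal_add]
  congr 2
  ext i
  simp

lemma conjDiag_sub : conjDiag U (f - g) = conjDiag U f - conjDiag U g := by
  rw [conjDiag, conjDiag, conjDiag, ← map_sub, diagonal_sub]
  congr 2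
  ext i
  simp

lemma conjDiag_smul (c : ℝ) : conjDiag U (c • f) = c • conjDiag U f := by
  rw [conjDiag, conjDiag, ← Complex.coe_smul c, ← map_smul, ← diagonal_smul]
  congr 2
  ext i
  simp

lemma conjDiag_mul : conjDiag U (f * g) = conjDiag U f * conjDiag U g := by
  rw [conjDiag, conjDiag, conjDiag, ← map_mul, diagonal_mul_diagonal]
  congr 2
  ext i
  simp

lemma isHermitian_conjDiag : (conjDiag U f).IsHermitian := by
  rw [IsHermitian, ← star_eq_conjTranspose, conjDiag, ← map_star, star_eq_conjTranspose,
    diagonal_conjTranspose]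
  congr 2
  ext i
  simp

variable {f} in
lemma posSemidef_conjDiag (hf : 0 ≤ f) : (conjDiag U f).PosSemidef := by
  rw [conjDiag, Unitary.conjStarAlgAut_apply]
  exact (PosSemidef.diagonal fun i => by simpa using hf i).mul_mul_conjTranspose_same _

lemma trace_conjDiag : (conjDiag U f).trace = (∑ i, f i : ℝ) := by
  rw [conjDiag, Unitary.conjStarAlgAut_apply, trace_mul_cycle, Unitary.coe_star_mul_self,
    Matrix.one_mul, trace_diagonal, Complex.ofReal_sum]
  rfl

lemma norm_conjDiag : ‖conjDiag U f‖ = ‖f‖ := by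
  rw [conjDiag, Unitary.conjStarAlgAut_apply, ← Unitary.coe_star, CStarRing.norm_mul_coe_unitary,
    CStarRing.norm_coe_unitary_mul, l2_opNorm_diagonal]
  simp [Pi.norm_def]

end ConjDiag

section PosSemidef

variable {n : Type*} [Fintype n]

lemma exists_eq_conjTranspose_mul_self {P : Matrix n n ℂ} (hP : P.PosSemidef) :
    ∃ C : Matrix n n ℂ, P = Cᴴ * C ∧ hsSq C = P.trace.re := by
  classical
  open scoped MatrixOrder in
  obtain ⟨C, hC⟩ := CStarAlgebra.nonneg_iff_eq_star_mul_self.mp (nonneg_iff_posSemidef.mpr hP)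
  rw [star_eq_conjTranspose] at hC
  exact ⟨C, hC, by rw [hC, trace_conjTranspose_mul_self, Complex.ofReal_re]⟩

lemma re_trace_nonneg {P : Matrix n n ℂ} (hP : P.PosSemidef) : 0 ≤ P.trace.re :=
  (Complex.le_def.mp hP.trace_nonneg).1

lemma posSemidef_of_isStarProjection {Q : Matrix n n ℂ} (hQ : IsStarProjection Q) :
    Q.PosSemidef := by
  have h := posSemidef_conjTranspose_mul_self Q
  rwa [← star_eq_conjTranspose, hQ.isSelfAdjoint.star_eq, hQ.isIdempotentElem.eq] at h

lemma re_trace_mul_nonneg {P Q : Matrix n n ℂ} (hP : P.PosSemidef) (hQ : Q.PosSemidef) :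
    0 ≤ (P * Q).trace.re := by
  obtain ⟨C, rfl, -⟩ := exists_eq_conjTranspose_mul_self hP
  rw [Matrix.mul_assoc, trace_mul_comm]
  exact re_trace_nonneg (hQ.mul_mul_conjTranspose_same C)

variable [DecidableEq n]

lemma norm_le_one_of_posSemidef {S : Matrix n n ℂ} (hS : S.PosSemidef)
    (hS1 : (1 - S).PosSemidef) : ‖S‖ ≤ 1 := by
  open scoped MatrixOrder in
  exact (CStarAlgebra.norm_le_one_iff_of_nonneg S (nonneg_iff_posSemidef.mpr hS)).mpr
    (le_iff.mpr hS1)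

lemma norm_sq_le_hsSq (Z : Matrix n n ℂ) : ‖Z‖ ^ 2 ≤ hsSq Z := by
  have hZ : (Zᴴ * Z).PosSemidef := posSemidef_conjTranspose_mul_self Z
  set t := hZ.1.eigenvalues
  have hZt : Zᴴ * Z = conjDiag hZ.1.eigenvectorUnitary t := eq_conjDiag_eigenvalues hZ.1
  have ht : ∑ i, t i = hsSq Z := by
    rw [← Complex.ofReal_inj, ← trace_conjDiag, ← hZt, trace_conjTranspose_mul_self]
  rw [sq, ← l2_opNorm_conjTranspose_mul_self, hZt, norm_conjDiag, ← ht,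
    pi_norm_le_iff_of_nonneg (Finset.sum_nonneg fun i _ => hZ.eigenvalues_nonneg i)]
  intro i
  rw [Real.norm_of_nonneg (hZ.eigenvalues_nonneg i)]
  exact Finset.single_le_sum (fun i _ => hZ.eigenvalues_nonneg i) (Finset.mem_univ i)

end PosSemidef

section TraceNorm

variable {n : Type*} [Fintype n] [DecidableEq n]

/-- The trace norm, defined as the norm dual to the operator norm under the pairing `Tr(X W)`. -/
def traceNorm (X : Matrix n n ℂ) : ℝ :=
  ‖LinearMap.toContinuousLinearMap
    ((LinearMap.mul ℂ (Matrix n n ℂ)).compr₂ (traceLinearMap n ℂ ℂ) X)‖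

variable (X Y : Matrix n n ℂ)

lemma norm_trace_mul_le_traceNorm_mul (W : Matrix n n ℂ) :
    ‖(X * W).trace‖ ≤ traceNorm X * ‖W‖ :=
  ContinuousLinearMap.le_opNorm (LinearMap.toContinuousLinearMap
    ((LinearMap.mul ℂ (Matrix n n ℂ)).compr₂ (traceLinearMap n ℂ ℂ) X)) W

lemma traceNorm_nonneg : 0 ≤ traceNorm X := norm_nonneg _

variable {X} in
lemma traceNorm_le_of_forall {c : ℝ} (hc : 0 ≤ c) (h : ∀ W, ‖(X * W).trace‖ ≤ c * ‖W‖) :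
    traceNorm X ≤ c :=
  ContinuousLinearMap.opNorm_le_bound _ hc h

lemma traceNorm_add_le : traceNorm (X + Y) ≤ traceNorm X + traceNorm Y := by
  simp only [traceNorm, map_add]
  exact norm_add_le _ _

lemma traceNorm_neg : traceNorm (-X) = traceNorm X := by
  simp only [traceNorm, map_neg, norm_neg]

lemma traceNorm_smul (c : ℝ) : traceNorm (c • X) = |c| * traceNorm X := by
  rw [← Complex.coe_smul]
  simp only [traceNorm, map_smul, norm_smul, Complex.norm_real, Real.norm_eq_abs]

lemma norm_trace_le_traceNorm : ‖X.trace‖ ≤ traceNorm X := by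
  calc ‖X.trace‖ = ‖(X * 1).trace‖ := by rw [Matrix.mul_one]
    _ ≤ traceNorm X * ‖(1 : Matrix n n ℂ)‖ := norm_trace_mul_le_traceNorm_mul X 1
    _ ≤ traceNorm X := mul_le_of_le_one_right (traceNorm_nonneg X)
        (norm_le_one_of_posSemidef .one (by simpa using .zero))

lemma traceNorm_mul_le : traceNorm (X * Y) ≤ √(hsSq X) * √(hsSq Y) := by
  refine traceNorm_le_of_forall (by positivity) fun W => ?_
  calc ‖(X * Y * W).trace‖ ≤ √(hsSq X) * √(hsSq (Y * W)) := by
        rw [Matrix.mul_assoc]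
        exact norm_trace_mul_le _ _
    _ ≤ √(hsSq X) * √(hsSq Y * ‖W‖ ^ 2) := by
        gcongr
        exact hsSq_mul_le_mul_norm_sq Y W
    _ = √(hsSq X) * √(hsSq Y) * ‖W‖ := by
        rw [Real.sqrt_mul (hsSq_nonneg Y), Real.sqrt_sq (norm_nonneg W), mul_assoc]

lemma norm_le_traceNorm : ‖X‖ ≤ traceNorm X := by
  rcases eq_or_ne X 0 with rfl | hX
  · simpa using traceNorm_nonneg 0
  refine le_of_mul_le_mul_right ?_ (norm_pos_iff.mpr hX)
  calc ‖X‖ * ‖X‖ ≤ hsSq X := (sq ‖X‖).symm.trans_le (norm_sq_le_hsSq X)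
    _ = ‖(X * Xᴴ).trace‖ := by
        rw [trace_mul_comm, trace_conjTranspose_mul_self, Complex.norm_of_nonneg (hsSq_nonneg X)]
    _ ≤ traceNorm X * ‖X‖ := by
        rw [← l2_opNorm_conjTranspose X]
        exact norm_trace_mul_le_traceNorm_mul X Xᴴ

variable {X Y}

lemma traceNorm_le_re_trace {P : Matrix n n ℂ} (hP : P.PosSemidef) :
    traceNorm P ≤ P.trace.re := by
  obtain ⟨C, hPC, hC⟩ := exists_eq_conjTranspose_mul_self hP
  calc traceNorm P = traceNorm (Cᴴ * C) := by rw [← hPC]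
    _ ≤ √(hsSq Cᴴ) * √(hsSq C) := traceNorm_mul_le Cᴴ C
    _ = P.trace.re := by rw [hsSq_conjTranspose, Real.mul_self_sqrt (hsSq_nonneg C), hC]

lemma traceNorm_le_of_isStarProjection_mul {Q : Matrix n n ℂ} (hQ : IsStarProjection Q)
    (hX : Q * X = X) : traceNorm X ≤ √Q.trace.re * √(hsSq X) := by
  calc traceNorm X = traceNorm (Q * X) := by rw [hX]
    _ ≤ √(hsSq Q) * √(hsSq X) := traceNorm_mul_le Q X
    _ = √Q.trace.re * √(hsSq X) := by rw [hsSq_of_isStarProjection hQ]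

/-- The gentle measurement lemma. -/
lemma traceNorm_sub_compression_le {G Q : Matrix n n ℂ} (hG : G.PosSemidef)
    (hQ : IsStarProjection Q) :
    traceNorm (G - Q * G * Q) ≤ 2 * (√(G * (1 - Q)).trace.re * √G.trace.re) := by
  obtain ⟨C, hGC, hC⟩ := exists_eq_conjTranspose_mul_self hG
  have hQ' := hQ.one_sub
  have hcut : hsSq (C * (1 - Q)) = (G * (1 - Q)).trace.re := by
    have hsq : (C * (1 - Q))ᴴ * (C * (1 - Q)) = (1 - Q) * (G * (1 - Q)) := by
      rw [conjTranspose_mul, ← star_eq_conjTranspose (1 - Q), hQ'.isSelfAdjoint.star_eq, hGC]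
      simp only [Matrix.mul_assoc]
    have h := trace_conjTranspose_mul_self (C * (1 - Q))
    rw [hsq, trace_mul_comm, Matrix.mul_assoc, hQ'.isIdempotentElem.eq] at h
    rw [h, Complex.ofReal_re]
  have hsplit : G - Q * G * Q = (C * (1 - Q))ᴴ * C + (C * Q)ᴴ * (C * (1 - Q)) := by
    rw [conjTranspose_mul, conjTranspose_mul, ← star_eq_conjTranspose Q,
      ← star_eq_conjTranspose (1 - Q), hQ.isSelfAdjoint.star_eq, hQ'.isSelfAdjoint.star_eq, hGC]
    noncomm_ring
  calc traceNorm (G - Q * G * Q)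
      ≤ √(hsSq (C * (1 - Q))ᴴ) * √(hsSq C) + √(hsSq (C * Q)ᴴ) * √(hsSq (C * (1 - Q))) := by
        rw [hsplit]
        exact (traceNorm_add_le _ _).trans
          (add_le_add (traceNorm_mul_le _ _) (traceNorm_mul_le _ _))
    _ ≤ √(hsSq (C * (1 - Q))) * √(hsSq C) + √(hsSq C) * √(hsSq (C * (1 - Q))) := by
        rw [hsSq_conjTranspose, hsSq_conjTranspose]
        gcongr
        exact hsSq_mul_le_of_norm_le_one hQ.norm_le C
    _ = 2 * (√(G * (1 - Q)).trace.re * √G.trace.re) := by rw [hcut, hC]; ring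

lemma exists_sign_decomposition {D : Matrix n n ℂ} (hD : D.IsHermitian) :
    ∃ P N W : Matrix n n ℂ, P.PosSemidef ∧ N.PosSemidef ∧ ‖W‖ ≤ 1 ∧
      D = P - N ∧ D * W = P + N ∧ W * D = P + N := by
  set U := hD.eigenvectorUnitary
  set t := hD.eigenvalues
  set s : n → ℝ := fun i => if 0 ≤ t i then 1 else -1
  have hts : t * s = t⁺ + t⁻ := by
    ext i
    simp only [s, Pi.mul_apply, Pi.add_apply, posPart_def, negPart_def]
    split_ifs with h
    · simp [h]
    · simp [(not_le.mp h).le]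
  have hDt : D = conjDiag U t := eq_conjDiag_eigenvalues hD
  refine ⟨conjDiag U t⁺, conjDiag U t⁻, conjDiag U s, posSemidef_conjDiag U (posPart_nonneg t),
    posSemidef_conjDiag U (negPart_nonneg t), ?_, ?_, ?_, ?_⟩
  · rw [norm_conjDiag, pi_norm_le_iff_of_nonneg zero_le_one]
    intro i
    simp only [s]
    split_ifs <;> simp
  · rw [← conjDiag_sub, posPart_sub_negPart, hDt]
  · rw [← conjDiag_add, hDt, ← conjDiag_mul, hts]
  · rw [← conjDiag_add, hDt, ← conjDiag_mul, mul_comm, hts]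

/-- The Powers–Størmer inequality. -/
lemma hsSq_sub_le_traceNorm (hX : X.PosSemidef) (hY : Y.PosSemidef) :
    hsSq (X - Y) ≤ traceNorm (X * X - Y * Y) := by
  have hD : (X - Y).IsHermitian := hX.1.sub hY.1
  obtain ⟨P, N, W, hP, hN, hW, hPN, hDW, hWD⟩ := exists_sign_decomposition hD
  have hpair : ((X * X - Y * Y) * W).trace = ((X + Y) * (P + N)).trace := by
    have h : (X * X - Y * Y) * W = X * ((X - Y) * W) + (X - Y) * Y * W := by noncomm_ring
    rw [h, trace_add, trace_mul_cycle (X - Y), hWD, hDW, trace_mul_comm (P + N), ← trace_add,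
      Matrix.add_mul]
  have hsq : hsSq (X - Y) = ((X - Y) * (P - N)).trace.re := by
    rw [← hPN, ← Complex.ofReal_re (hsSq (X - Y)), ← trace_conjTranspose_mul_self, hD.eq]
  have hexpand : ((X + Y) * (P + N)).trace.re =
      ((X - Y) * (P - N)).trace.re + 2 * (X * N).trace.re + 2 * (Y * P).trace.re := by
    simp only [Matrix.add_mul, Matrix.sub_mul, Matrix.mul_add, Matrix.mul_sub, trace_add,
      trace_sub, Complex.add_re, Complex.sub_re]
    ring
  calc hsSq (X - Y) ≤ ((X + Y) * (P + N)).trace.re := by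
        linarith [re_trace_mul_nonneg hX hN, re_trace_mul_nonneg hY hP]
    _ ≤ ‖((X * X - Y * Y) * W).trace‖ := hpair ▸ Complex.re_le_norm _
    _ ≤ traceNorm (X * X - Y * Y) * ‖W‖ := norm_trace_mul_le_traceNorm_mul _ _
    _ ≤ traceNorm (X * X - Y * Y) := mul_le_of_le_one_right (traceNorm_nonneg _) hW

lemma traceNorm_sandwich_sub_le {r h S : Matrix n n ℂ} (hr : r.PosSemidef) (hh : h.PosSemidef)
    (hS : ‖S‖ ≤ 1) (hr1 : hsSq r ≤ 1) (hrh : traceNorm (r * r - h * h) ≤ 1) :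
    traceNorm (r * S * r - h * S * h) ≤ 3 * √(traceNorm (r * r - h * h)) := by
  set c := traceNorm (r * r - h * h)
  have hrsub : √(hsSq (r - h)) ≤ √c := Real.sqrt_le_sqrt (hsSq_sub_le_traceNorm hr hh)
  have hh4 : hsSq h ≤ 2 ^ 2 := by
    have hre : (r * r - h * h).trace.re = hsSq r - hsSq h := by
      rw [← Complex.ofReal_re (hsSq r - hsSq h), Complex.ofReal_sub,
        ← trace_conjTranspose_mul_self, ← trace_conjTranspose_mul_self, hr.1.eq, hh.1.eq, trace_sub]
    have := (Complex.abs_re_le_norm _).trans (norm_trace_le_traceNorm (r * r - h * h))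
    rw [hre] at this
    linarith [abs_le.mp this]
  have hsplit : r * S * r - h * S * h = r * S * (r - h) + (r - h) * (S * h) := by noncomm_ring
  calc traceNorm (r * S * r - h * S * h)
      ≤ √(hsSq (r * S)) * √(hsSq (r - h)) + √(hsSq (r - h)) * √(hsSq (S * h)) := by
        rw [hsplit]
        exact (traceNorm_add_le _ _).trans
          (add_le_add (traceNorm_mul_le _ _) (traceNorm_mul_le _ _))
    _ ≤ 1 * √c + √c * 2 := by
        gcongr
        · exact Real.sqrt_le_one.mpr ((hsSq_mul_le_of_norm_le_one hS r).trans hr1)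
        · exact Real.sqrt_le_iff.mpr
            ⟨zero_le_two, (hsSq_mul_le_of_norm_le_one' hS h).trans hh4⟩
    _ = 3 * √c := by ring

end TraceNorm

section TensorProd

variable {κ : Type*} [Fintype κ] {d : ℕ}

lemma tensorProd_one : tensorProd (fun _ : κ => (1 : Matrix (Fin d) (Fin d) ℂ)) = 1 := by
  ext x y
  simp only [tensorProd, of_apply, one_apply, Finset.prod_ite_zero, Finset.prod_const_one,
    Finset.mem_univ, true_implies, funext_iff]

lemma conjTranspose_tensorProd (B : κ → Matrix (Fin d) (Fin d) ℂ) :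
    (tensorProd B)ᴴ = tensorProd fun k => (B k)ᴴ := by
  ext x y
  simp only [tensorProd, conjTranspose_apply, of_apply, star_prod]

lemma tensorProd_diagonal (f : κ → Fin d → ℂ) :
    tensorProd (fun k => diagonal (f k)) = diagonal fun x => ∏ k, f k (x k) := by
  ext x y
  simp only [tensorProd, of_apply, diagonal_apply, Finset.prod_ite_zero,
    Finset.mem_univ, true_implies, funext_iff]

variable [DecidableEq κ]

lemma tensorProd_mul (B C : κ → Matrix (Fin d) (Fin d) ℂ) :
    tensorProd (fun k => B k * C k) = tensorProd B * tensorProd C := by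
  ext x y
  simp only [tensorProd, mul_apply, of_apply, Finset.prod_univ_sum, Fintype.piFinset_univ,
    Finset.prod_mul_distrib]

lemma trace_tensorProd (B : κ → Matrix (Fin d) (Fin d) ℂ) :
    (tensorProd B).trace = ∏ k, (B k).trace := by
  simp only [trace, diag, tensorProd, of_apply, Finset.prod_univ_sum, Fintype.piFinset_univ]

lemma sum_piFinset_tensorProd {m : ℕ} (s : κ → Finset (Fin m))
    (a : Fin m → Matrix (Fin d) (Fin d) ℂ) :
    ∑ J ∈ Fintype.piFinset s, tensorProd (fun k => a (J k)) =
      tensorProd fun k => ∑ i ∈ s k, a i := by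
  ext x y
  simp only [tensorProd, Matrix.sum_apply, of_apply, Finset.prod_univ_sum]

omit [DecidableEq κ] in
lemma posSemidef_tensorProd {B : κ → Matrix (Fin d) (Fin d) ℂ} (hB : ∀ k, (B k).PosSemidef) :
    (tensorProd B).PosSemidef := by
  classical
  choose C hC _ using fun k => exists_eq_conjTranspose_mul_self (hB k)
  rw [funext hC, tensorProd_mul, ← conjTranspose_tensorProd]
  exact posSemidef_conjTranspose_mul_self _

/-- The tensor product of unitaries, as a unitary. -/
def tensorUnitary (U : κ → unitaryGroup (Fin d) ℂ) : unitaryGroup (κ → Fin d) ℂ :=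
  ⟨tensorProd fun k => U k, mem_unitaryGroup_iff.mpr <| by
    rw [star_eq_conjTranspose, conjTranspose_tensorProd, ← tensorProd_mul, ← tensorProd_one]
    congr 1
    ext1 k
    exact Unitary.coe_mul_star_self (U k)⟩

lemma tensorProd_conjDiag (U : κ → unitaryGroup (Fin d) ℂ) (f : κ → Fin d → ℝ) :
    tensorProd (fun k => conjDiag (U k) (f k)) =
      conjDiag (tensorUnitary U) fun x => ∏ k, f k (x k) := by
  simp only [conjDiag, Unitary.conjStarAlgAut_apply, tensorProd_mul, tensorProd_diagonal]
  congr 2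
  · congr 1
    ext x
    simp
  · exact (conjTranspose_tensorProd _).symm

lemma norm_tensorProd_le (B : κ → Matrix (Fin d) (Fin d) ℂ) : ‖tensorProd B‖ ≤ ∏ k, ‖B k‖ := by
  have hH (k : κ) : ((B k)ᴴ * B k).IsHermitian := isHermitian_conjTranspose_mul_self _
  set t : κ → Fin d → ℝ := fun k => (hH k).eigenvalues
  have hBt (k : κ) : (B k)ᴴ * B k = conjDiag (hH k).eigenvectorUnitary (t k) :=
    eq_conjDiag_eigenvalues (hH k)
  have hnorm (k : κ) : ‖t k‖ = ‖B k‖ ^ 2 := by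
    rw [← norm_conjDiag, ← hBt, l2_opNorm_conjTranspose_mul_self, sq]
  refine le_of_sq_le_sq ?_ (Finset.prod_nonneg fun k _ => norm_nonneg _)
  calc ‖tensorProd B‖ ^ 2 = ‖fun x : κ → Fin d => ∏ k, t k (x k)‖ := by
        rw [sq, ← l2_opNorm_conjTranspose_mul_self, conjTranspose_tensorProd, ← tensorProd_mul,
          funext hBt, tensorProd_conjDiag, norm_conjDiag]
    _ ≤ ∏ k, ‖t k‖ := by
        refine (pi_norm_le_iff_of_nonneg (Finset.prod_nonneg fun k _ => norm_nonneg _)).mpr ?_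
        intro x
        rw [norm_prod]
        exact Finset.prod_le_prod (fun _ _ => norm_nonneg _) fun k _ => norm_le_pi_norm (t k) (x k)
    _ = (∏ k, ‖B k‖) ^ 2 := by rw [← Finset.prod_pow, Finset.prod_congr rfl fun k _ => hnorm k]

end TensorProd

section PartialTrace

open scoped Kronecker

variable {l d m : ℕ} (K : Finset (Fin l))

/-- The splitting of a product basis label into its parts inside and outside `K`. -/
def splitEquiv : (Fin l → Fin d) ≃ (K → Fin d) × ({k : Fin l // k ∉ K} → Fin d) :=
  Equiv.piEquivPiSubtypeProd (fun k => k ∈ K) fun _ => Fin d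

/-- The operator `A ⊗ B` with `A` acting on the factors in `K` and `B` on the others. -/
def split (A : Matrix (K → Fin d) (K → Fin d) ℂ)
    (B : Matrix ({k : Fin l // k ∉ K} → Fin d) ({k : Fin l // k ∉ K} → Fin d) ℂ) :
    Matrix (Fin l → Fin d) (Fin l → Fin d) ℂ :=
  (A ⊗ₖ B).submatrix (splitEquiv K) (splitEquiv K)

lemma splitEquiv_symm_apply (x : K → Fin d) (z : {k : Fin l // k ∉ K} → Fin d) :
    (splitEquiv K).symm (x, z) = glue K x z :=
  rfl

lemma splitEquiv_glue (x : K → Fin d) (z : {k : Fin l // k ∉ K} → Fin d) :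
    splitEquiv K (glue K x z) = (x, z) :=
  (splitEquiv K).apply_symm_apply (x, z)

lemma split_mul (A A' : Matrix (K → Fin d) (K → Fin d) ℂ)
    (B B' : Matrix ({k : Fin l // k ∉ K} → Fin d) ({k : Fin l // k ∉ K} → Fin d) ℂ) :
    split K (A * A') (B * B') = split K A B * split K A' B' := by
  rw [split, split, split, submatrix_mul_equiv, mul_kronecker_mul]

lemma tensorProd_eq_split (B : Fin l → Matrix (Fin d) (Fin d) ℂ) :
    tensorProd B = split K (tensorProd fun k : K => B k)
      (tensorProd fun k : {k : Fin l // k ∉ K} => B k) := by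
  ext x y
  simp only [tensorProd, split, of_apply, submatrix_apply, kroneckerMap_apply]
  refine (Fintype.prod_subtype_mul_prod_subtype (fun k => k ∈ K)
    fun k => B k (x k) (y k)).symm.trans ?_
  congr!

lemma partialTrace_split (A : Matrix (K → Fin d) (K → Fin d) ℂ)
    (B : Matrix ({k : Fin l // k ∉ K} → Fin d) ({k : Fin l // k ∉ K} → Fin d) ℂ) :
    partialTrace K (split K A B) = B.trace • A := by
  ext x y
  simp only [partialTrace, split, of_apply, submatrix_apply, splitEquiv_glue, kroneckerMap_apply,
    Matrix.smul_apply, trace, diag, smul_eq_mul, Finset.sum_mul, mul_comm (A x y)]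

/-- The partial trace over the factors outside `K` is adjoint to `W ↦ W ⊗ 1`. -/
lemma trace_partialTrace_mul (Z : Matrix (Fin l → Fin d) (Fin l → Fin d) ℂ)
    (W : Matrix (K → Fin d) (K → Fin d) ℂ) :
    (partialTrace K Z * W).trace = (Z * split K W 1).trace := by
  have hentry (x : K → Fin d) (z : {k : Fin l // k ∉ K} → Fin d) :
      (Z * split K W 1) (glue K x z) (glue K x z) = ∑ y, Z (glue K x z) (glue K y z) * W y x := by
    simp only [mul_apply, ← (splitEquiv K).symm.sum_comp, Fintype.sum_prod_type,
      splitEquiv_symm_apply, split, submatrix_apply, splitEquiv_glue, kroneckerMap_apply, one_apply,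
      mul_ite, mul_one, mul_zero, Finset.sum_ite_eq', Finset.mem_univ, if_true]
  calc (partialTrace K Z * W).trace
      = ∑ x, ∑ z, ∑ y, Z (glue K x z) (glue K y z) * W y x := by
        simp only [trace, diag, mul_apply, partialTrace, of_apply, Finset.sum_mul]
        exact Finset.sum_congr rfl fun x _ => Finset.sum_comm
    _ = (Z * split K W 1).trace := by
        simp only [trace, diag, ← (splitEquiv K).symm.sum_comp, Fintype.sum_prod_type,
          splitEquiv_symm_apply, hentry]

lemma partialTrace_split_mul_mul_split (A A' : Matrix (K → Fin d) (K → Fin d) ℂ)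
    (B B' : Matrix ({k : Fin l // k ∉ K} → Fin d) ({k : Fin l // k ∉ K} → Fin d) ℂ)
    (Z : Matrix (Fin l → Fin d) (Fin l → Fin d) ℂ) :
    partialTrace K (split K A B * Z * split K A' B') =
      A * partialTrace K (split K 1 (B' * B) * Z) * A' := by
  refine ext_iff_trace_mul_right.mpr fun W => ?_
  calc (partialTrace K (split K A B * Z * split K A' B') * W).trace
      = (Z * split K (A' * W * A) (B' * B)).trace := by
        rw [trace_partialTrace_mul, Matrix.mul_assoc, Matrix.mul_assoc, trace_mul_comm,
          Matrix.mul_assoc, ← split_mul, ← split_mul, Matrix.mul_one]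
    _ = (partialTrace K (split K 1 (B' * B) * Z) * (A' * W * A)).trace := by
        rw [trace_partialTrace_mul, trace_mul_cycle, ← split_mul, trace_mul_comm, Matrix.one_mul,
          Matrix.mul_one]
    _ = _ := by
        rw [← Matrix.mul_assoc, trace_mul_comm]
        simp only [Matrix.mul_assoc]

/-- The inclusion `W ↦ W ⊗ 1` as a homomorphism of star algebras, whence contractive. -/
def inclusion : Matrix (K → Fin d) (K → Fin d) ℂ →⋆ₐ[ℂ]
    Matrix (Fin l → Fin d) (Fin l → Fin d) ℂ where
  toFun W := split K W 1
  map_one' := by simp [split]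
  map_mul' A B := by rw [← split_mul, Matrix.mul_one]
  map_zero' := by simp [split]
  map_add' A B := by rw [split, add_kronecker]; rfl
  commutes' c := by
    rw [Algebra.algebraMap_eq_smul_one, Algebra.algebraMap_eq_smul_one, split, smul_kronecker,
      one_kronecker_one, ← submatrix_one_equiv (splitEquiv K)]
    rfl
  map_star' A := by
    simp only [split, star_eq_conjTranspose, conjTranspose_submatrix, conjTranspose_kronecker,
      conjTranspose_one]

lemma norm_split_one_le (W : Matrix (K → Fin d) (K → Fin d) ℂ) : ‖split K W 1‖ ≤ ‖W‖ :=
  NonUnitalStarAlgHom.norm_apply_le (inclusion K) W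

lemma traceNorm_partialTrace_le (Z : Matrix (Fin l → Fin d) (Fin l → Fin d) ℂ) :
    traceNorm (partialTrace K Z) ≤ traceNorm Z := by
  refine traceNorm_le_of_forall (traceNorm_nonneg Z) fun W => ?_
  rw [trace_partialTrace_mul]
  exact (norm_trace_mul_le_traceNorm_mul Z _).trans
    (mul_le_mul_of_nonneg_left (norm_split_one_le K W) (traceNorm_nonneg Z))

lemma tensorProd_ite_eq_split (ρ : Matrix (Fin d) (Fin d) ℂ) :
    tensorProd (fun k => if k ∈ K then 1 else ρ) =
      split K 1 (tensorProd fun _ : {k : Fin l // k ∉ K} => ρ) := by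
  rw [tensorProd_eq_split K, ← tensorProd_one]
  congr! 3 with k k
  · exact if_pos k.2
  · exact if_neg k.2

/-- The invertible weight `w = √ρ` can be moved from the factors outside `K` to all factors, at the
cost of `‖w⁻¹‖²` for each factor in `K`. -/
lemma norm_partialTrace_le {w : Matrix (Fin d) (Fin d) ℂ} (hw : IsUnit w)
    (Y : Matrix (Fin l → Fin d) (Fin l → Fin d) ℂ) :
    ‖partialTrace K (tensorProd (fun k => if k ∈ K then 1 else w * w) * Y)‖ ≤
      (‖w⁻¹‖ ^ 2) ^ K.card *
        traceNorm (tensorProd (fun _ : Fin l => w) * Y * tensorProd fun _ : Fin l => w) := by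
  set r := tensorProd fun _ : Fin l => w
  set wK := tensorProd fun _ : K => w
  set wC := tensorProd fun _ : {k : Fin l // k ∉ K} => w
  set s := tensorProd fun _ : K => w⁻¹
  have hdet : IsUnit w.det := (isUnit_iff_isUnit_det w).mp hw
  have hsw : s * wK = 1 := by simp only [s, wK, ← tensorProd_mul, nonsing_inv_mul w hdet,
    tensorProd_one]
  have hws : wK * s = 1 := mul_eq_one_comm.mp hsw
  have hr : r = split K wK wC := tensorProd_eq_split K _
  have hpt : partialTrace K (tensorProd (fun k => if k ∈ K then 1 else w * w) * Y) =
      s * partialTrace K (r * Y * r) * s := by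
    rw [hr, partialTrace_split_mul_mul_split, tensorProd_ite_eq_split, tensorProd_mul]
    simp only [Matrix.mul_assoc]
    rw [hws, Matrix.mul_one, ← Matrix.mul_assoc s, hsw, Matrix.one_mul]
  have hs : ‖s‖ ≤ ‖w⁻¹‖ ^ K.card := by
    refine (norm_tensorProd_le _).trans_eq ?_
    rw [Finset.prod_const, Finset.card_univ, Fintype.card_coe]
  calc ‖partialTrace K (tensorProd (fun k => if k ∈ K then 1 else w * w) * Y)‖
      ≤ ‖s‖ * ‖partialTrace K (r * Y * r)‖ * ‖s‖ := by
        rw [hpt]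
        exact norm_mul₃_le
    _ ≤ ‖w⁻¹‖ ^ K.card * traceNorm (r * Y * r) * ‖w⁻¹‖ ^ K.card := by
        have hpt_le := (norm_le_traceNorm _).trans (traceNorm_partialTrace_le K (r * Y * r))
        have hr_nonneg := traceNorm_nonneg (r * Y * r)
        gcongr
    _ = (‖w⁻¹‖ ^ 2) ^ K.card * traceNorm (r * Y * r) := by ring

lemma filter_eq_piFinset (j : K → Fin m) :
    (Finset.univ.filter fun J : Fin l → Fin m => ∀ k : K, J k = j k) =
      Fintype.piFinset fun k => if h : k ∈ K then {j ⟨k, h⟩} else Finset.univ := by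
  ext J
  simp only [Finset.mem_filter, Finset.mem_univ, true_and, Fintype.mem_piFinset, Subtype.forall]
  refine forall_congr' fun k => ?_
  by_cases h : k ∈ K <;> simp [h]

lemma restriction_product {ρ : Matrix (Fin d) (Fin d) ℂ} (hρ1 : ρ.trace = 1)
    {a : Fin m → Matrix (Fin d) (Fin d) ℂ} (ha : ∑ i, a i = 1) (j : K → Fin m) :
    restriction ρ id (fun J : Fin l → Fin m => tensorProd fun k => a (J k)) K j =
      tensorProd fun k : K => a (j k) := by
  rw [restriction]
  simp only [id]
  rw [filter_eq_piFinset, sum_piFinset_tensorProd,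
    tensorProd_ite_eq_split, tensorProd_eq_split K, ← split_mul, ← tensorProd_mul,
    partialTrace_split, trace_tensorProd, Matrix.one_mul]
  have houtside (k : {k : Fin l // k ∉ K}) :
      (ρ * ∑ i ∈ if h : (k : Fin l) ∈ K then {j ⟨k, h⟩} else Finset.univ, a i).trace = 1 := by
    rw [dif_neg k.2, ha, Matrix.mul_one, hρ1]
  simp only [houtside, Finset.prod_const_one, one_smul]
  congr! with k
  simp

end PartialTrace

section Sampling

variable {ι E : Type*} [Fintype ι] [NormedAddCommGroup E] [InnerProductSpace ℝ E] {P : ι → ℝ}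

lemma exists_le_sum_mul (hP : ∀ i, 0 ≤ P i) (hP1 : ∑ i, P i = 1) (f : ι → ℝ) :
    ∃ i, f i ≤ ∑ j, P j * f j := by
  have : Nonempty ι := by
    by_contra hι
    rw [not_nonempty_iff] at hι
    simp at hP1
  obtain ⟨i, hi⟩ := Finite.exists_min f
  refine ⟨i, ?_⟩
  calc f i = ∑ j, P j * f i := by rw [← Finset.sum_mul, hP1, one_mul]
    _ ≤ ∑ j, P j * f j := Finset.sum_le_sum fun j _ => mul_le_mul_of_nonneg_left (hi j) (hP j)

lemma sum_mul_norm_add_sq (hP1 : ∑ i, P i = 1) {Z : ι → E} (hZ : ∑ i, P i • Z i = 0) (v : E) :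
    ∑ i, P i * ‖Z i + v‖ ^ 2 = ∑ i, P i * ‖Z i‖ ^ 2 + ‖v‖ ^ 2 := by
  have hterm (i : ι) : P i * ‖Z i + v‖ ^ 2 =
      P i * ‖Z i‖ ^ 2 + 2 * inner ℝ (P i • Z i) v + P i * ‖v‖ ^ 2 := by
    rw [norm_add_sq_real, real_inner_smul_left]
    ring
  simp only [hterm, Finset.sum_add_distrib, ← Finset.mul_sum, ← sum_inner, hZ, inner_zero_left,
    mul_zero, add_zero, ← Finset.sum_mul, hP1, one_mul]

/-- The samples are chosen one at a time, so that the expected cross term vanishes at each step. -/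
lemma exists_norm_sum_sq_le (hP : ∀ i, 0 ≤ P i) (hP1 : ∑ i, P i = 1) {Z : ι → E}
    (hZ : ∑ i, P i • Z i = 0) (N : ℕ) :
    ∃ J : Fin N → ι, ‖∑ μ, Z (J μ)‖ ^ 2 ≤ N * ∑ i, P i * ‖Z i‖ ^ 2 := by
  induction N with
  | zero => exact ⟨Fin.elim0, by simp⟩
  | succ N ih =>
    obtain ⟨J, hJ⟩ := ih
    obtain ⟨i, hi⟩ := exists_le_sum_mul hP hP1 fun i => ‖Z i + ∑ μ, Z (J μ)‖ ^ 2
    rw [sum_mul_norm_add_sq hP1 hZ] at hi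
    refine ⟨Fin.cons i J, ?_⟩
    simp only [Fin.sum_univ_succ, Fin.cons_zero, Fin.cons_succ]
    push_cast
    linarith

lemma exists_norm_sum_sub_sq_le (hP : ∀ i, 0 ≤ P i) (hP1 : ∑ i, P i = 1) (Y : ι → E) (N : ℕ) :
    ∃ J : Fin N → ι,
      ‖∑ μ, Y (J μ) - (N : ℝ) • ∑ i, P i • Y i‖ ^ 2 ≤ N * ∑ i, P i * ‖Y i‖ ^ 2 := by
  set e := ∑ i, P i • Y i
  have hcentred : ∑ i, P i • (Y i - e) = 0 := by
    simp only [smul_sub, Finset.sum_sub_distrib, ← Finset.sum_smul, hP1, one_smul]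
    exact sub_self e
  obtain ⟨J, hJ⟩ := exists_norm_sum_sq_le hP hP1 hcentred N
  have hvariance : ∑ i, P i * ‖Y i - e‖ ^ 2 ≤ ∑ i, P i * ‖Y i‖ ^ 2 := by
    have h := sum_mul_norm_add_sq hP1 hcentred e
    simp only [sub_add_cancel] at h
    linarith [sq_nonneg ‖e‖]
  have hsum : ∑ μ, (Y (J μ) - e) = ∑ μ, Y (J μ) - (N : ℝ) • e := by
    rw [Finset.sum_sub_distrib, Finset.sum_const, Finset.card_univ, Fintype.card_fin,
      Nat.cast_smul_eq_nsmul]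
  rw [hsum] at hJ
  exact ⟨J, hJ.trans (mul_le_mul_of_nonneg_left hvariance (Nat.cast_nonneg N))⟩

lemma exists_sum_norm_sum_sub_sq_le {κ : Type*} [Fintype κ] (hP : ∀ i, 0 ≤ P i)
    (hP1 : ∑ i, P i = 1) (Y : ι → κ → E) (N : ℕ) :
    ∃ J : Fin N → ι, ∑ k, ‖∑ μ, Y (J μ) k - (N : ℝ) • ∑ i, P i • Y i k‖ ^ 2 ≤
      N * ∑ i, P i * ∑ k, ‖Y i k‖ ^ 2 := by
  obtain ⟨J, hJ⟩ := exists_norm_sum_sub_sq_le (E := PiLp 2 fun _ : κ => E) hP hP1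
    (fun i => WithLp.toLp 2 (Y i)) N
  refine ⟨J, ?_⟩
  simpa only [PiLp.norm_sq_eq_of_L2, PiLp.sub_apply, PiLp.smul_apply, WithLp.ofLp_sum,
    Finset.sum_apply, PiLp.toLp_apply] using hJ

lemma exists_hsSq_sum_sub_le {n I : Type*} [Fintype n] [Fintype I] (hP : ∀ i, 0 ≤ P i)
    (hP1 : ∑ i, P i = 1) (X : ι → Matrix n n ℂ) {t : ℝ} (hX : ∀ i, hsSq (X i) ≤ t)
    (E : I → ι → Prop) [∀ i, DecidablePred (E i)] (N : ℕ) :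
    ∃ J : Fin N → ι, ∀ i, hsSq (∑ μ with E i (J μ), X (J μ) -
      (N : ℝ) • ∑ j with E i j, P j • X j) ≤ N * (Fintype.card I * t) := by
  set Y : ι → I × n × n → ℂ := fun j k => if E k.1 j then X j k.2.1 k.2.2 else 0
  have hY (j : ι) : ∑ k, ‖Y j k‖ ^ 2 ≤ Fintype.card I * t := by
    have hblock (i : I) : ∑ p : n × n, ‖Y j (i, p)‖ ^ 2 ≤ t := by
      refine le_trans ?_ (hX j)
      simp only [Y, hsSq, Fintype.sum_prod_type]
      gcongr
      split_ifs <;> simp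
    calc ∑ k, ‖Y j k‖ ^ 2 ≤ ∑ _i : I, t := by
          rw [Fintype.sum_prod_type]
          exact Finset.sum_le_sum fun i _ => hblock i
      _ = Fintype.card I * t := by rw [Finset.sum_const, Finset.card_univ, nsmul_eq_mul]
  obtain ⟨J, hJ⟩ := exists_sum_norm_sum_sub_sq_le hP hP1 Y N
  refine ⟨J, fun i => ?_⟩
  calc hsSq (∑ μ with E i (J μ), X (J μ) - (N : ℝ) • ∑ j with E i j, P j • X j)
      = ∑ p : n × n, ‖∑ μ, Y (J μ) (i, p) - (N : ℝ) • ∑ j, P j • Y j (i, p)‖ ^ 2 := by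
        simp only [hsSq, Fintype.sum_prod_type, Matrix.sub_apply, Matrix.smul_apply,
          Matrix.sum_apply, Y, smul_ite, smul_zero, ← Finset.sum_filter]
    _ ≤ ∑ k, ‖∑ μ, Y (J μ) k - (N : ℝ) • ∑ j, P j • Y j k‖ ^ 2 := by
        refine le_of_le_of_eq ?_ (Fintype.sum_prod_type _).symm
        exact Finset.single_le_sum (f := fun i' => ∑ p : n × n,
            ‖∑ μ, Y (J μ) (i', p) - (N : ℝ) • ∑ j, P j • Y j (i', p)‖ ^ 2)
          (fun _ _ => Finset.sum_nonneg fun _ _ => by positivity) (Finset.mem_univ i)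
    _ ≤ N * ∑ j, P j * ∑ k, ‖Y j k‖ ^ 2 := hJ
    _ ≤ N * ∑ j, P j * (Fintype.card I * t) := by
        gcongr with j
        exacts [hP j, hY j]
    _ = N * (Fintype.card I * t) := by rw [← Finset.sum_mul, hP1, one_mul]

end Sampling

section LargeDeviations

open Filter Topology

variable {α : Type*} [Fintype α] {Q : α → ℝ}

lemma exists_sum_mul_exp_lt_one (hQ1 : ∑ a, Q a = 1) {g : α → ℝ} (hg : ∑ a, Q a * g a < 0) :
    ∃ s, 0 < s ∧ ∑ a, Q a * Real.exp (s * g a) < 1 := by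
  set φ : ℝ → ℝ := fun s => ∑ a, Q a * Real.exp (s * g a)
  have hφ0 : φ 0 = 1 := by simp only [φ, zero_mul, Real.exp_zero, mul_one, hQ1]
  have hderiv : HasDerivAt φ (∑ a, Q a * g a) 0 := by
    refine HasDerivAt.fun_sum fun a _ => ?_
    simpa using (((hasDerivAt_id (0 : ℝ)).mul_const (g a)).exp).const_mul (Q a)
  have hslope : ∀ᶠ s in 𝓝[>] 0, slope φ 0 s < 0 :=
    ((hasDerivAt_iff_tendsto_slope.mp hderiv).mono_left
      (nhdsWithin_mono 0 fun _ hx => ne_of_gt hx)).eventually (gt_mem_nhds hg)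
  obtain ⟨s, hs, hs0⟩ := (hslope.and self_mem_nhdsWithin).exists
  refine ⟨s, hs0, ?_⟩
  rw [slope_def_field, sub_zero, div_lt_iff₀ hs0, hφ0] at hs
  linarith

lemma sum_prod_le_sum_mul_exp_pow (hQ : ∀ a, 0 ≤ Q a) (g : α → ℝ) {s : ℝ} (hs : 0 ≤ s) (l : ℕ) :
    ∑ x : Fin l → α with 0 ≤ ∑ k, g (x k), ∏ k, Q (x k) ≤
      (∑ a, Q a * Real.exp (s * g a)) ^ l := by
  calc ∑ x : Fin l → α with 0 ≤ ∑ k, g (x k), ∏ k, Q (x k)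
      ≤ ∑ x : Fin l → α with 0 ≤ ∑ k, g (x k), ∏ k, (Q (x k) * Real.exp (s * g (x k))) := by
        refine Finset.sum_le_sum fun x hx => ?_
        rw [Finset.prod_mul_distrib, ← Real.exp_sum, ← Finset.mul_sum]
        exact le_mul_of_one_le_right (Finset.prod_nonneg fun k _ => hQ _)
          (Real.one_le_exp (mul_nonneg hs (Finset.mem_filter.mp hx).2))
    _ ≤ ∑ x : Fin l → α, ∏ k, (Q (x k) * Real.exp (s * g (x k))) :=
        Finset.sum_le_univ_sum_of_nonneg fun x =>
          Finset.prod_nonneg fun k _ => mul_nonneg (hQ _) (Real.exp_pos _).le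
    _ = (∑ a, Q a * Real.exp (s * g a)) ^ l := by
        rw [← Fintype.piFinset_univ,
          ← Finset.prod_univ_sum (fun _ : Fin l => Finset.univ) fun _ a => Q a * Real.exp (s * g a),
          Finset.prod_const, Finset.card_univ, Fintype.card_fin]

lemma exists_large_deviation_bound (hQ : ∀ a, 0 ≤ Q a) (hQ1 : ∑ a, Q a = 1) {f : α → ℝ} {c : ℝ}
    (hc : ∑ a, Q a * f a < c) :
    ∃ κ > 0, ∀ l : ℕ, ∑ x : Fin l → α with l * c ≤ ∑ k, f (x k), ∏ k, Q (x k) ≤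
      Real.exp (-κ * l) := by
  have hneg : ∑ a, Q a * (f a - c) < 0 := by
    simp only [mul_sub, Finset.sum_sub_distrib, ← Finset.sum_mul, hQ1]
    linarith
  obtain ⟨s, hs0, hs1⟩ := exists_sum_mul_exp_lt_one hQ1 hneg
  set r := ∑ a, Q a * Real.exp (s * (f a - c))
  have hr : 0 < r := by
    obtain ⟨a, -, ha⟩ : ∃ a ∈ Finset.univ, 0 < Q a :=
      Finset.exists_lt_of_sum_lt (by rw [hQ1]; simp)
    exact Finset.sum_pos' (fun a _ => mul_nonneg (hQ a) (Real.exp_pos _).le)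
      ⟨a, Finset.mem_univ a, mul_pos ha (Real.exp_pos _)⟩
  refine ⟨-Real.log r, neg_pos.mpr (Real.log_neg hr hs1), fun l => ?_⟩
  rw [neg_neg, mul_comm (Real.log r), Real.exp_nat_mul, Real.exp_log hr]
  refine le_of_eq_of_le ?_ (sum_prod_le_sum_mul_exp_pow hQ (fun a => f a - c) hs0.le l)
  simp only [Finset.sum_sub_distrib, Finset.sum_const, Finset.card_univ, Fintype.card_fin,
    nsmul_eq_mul, sub_nonneg]

end LargeDeviations

section MarginalIndex

open Filter

/-- The index set of the marginals that are compared in `restrictionError`: a set `K` of at most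
`ν` factors together with outcomes for the factors in `K`. -/
abbrev MarginalIndex (l m ν : ℕ) : Type :=
  Σ K : {K : Finset (Fin l) // K.card ≤ ν}, K.1 → Fin m

instance (l m ν : ℕ) : Nonempty (MarginalIndex l m ν) :=
  ⟨⟨⟨∅, by simp⟩, fun k => absurd k.2 (Finset.notMem_empty _)⟩⟩

lemma card_marginalIndex_mul_pow_le (l m ν : ℕ) {y : ℝ} (hy : 0 ≤ y) (hy1 : y ≤ 1) :
    Fintype.card (MarginalIndex l m ν) * y ^ ν ≤ Real.exp (l * (m * y)) := by
  calc Fintype.card (MarginalIndex l m ν) * y ^ ν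
      = ∑ K : {K : Finset (Fin l) // K.card ≤ ν}, (m : ℝ) ^ K.1.card * y ^ ν := by
        simp [Fintype.card_sigma, Finset.sum_mul]
    _ ≤ ∑ K : {K : Finset (Fin l) // K.card ≤ ν}, (m * y) ^ K.1.card := by
        refine Finset.sum_le_sum fun K _ => ?_
        rw [mul_pow]
        exact mul_le_mul_of_nonneg_left (pow_le_pow_of_le_one hy hy1 K.2) (by positivity)
    _ ≤ ∑ K : Finset (Fin l), (m * y) ^ K.card := by
        rw [← Finset.sum_subtype (p := fun K => K.card ≤ ν) {K | K.card ≤ ν} (by simp)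
          fun K : Finset (Fin l) => (m * y) ^ K.card]
        exact Finset.sum_le_univ_sum_of_nonneg fun K => by positivity
    _ = (m * y + 1) ^ l := by
        simpa using Fintype.sum_pow_mul_eq_add_pow (Fin l) (m * y) 1
    _ ≤ Real.exp (l * (m * y)) := by
        rw [Real.exp_nat_mul]
        gcongr
        exact Real.add_one_le_exp _

lemma eventually_card_marginalIndex_mul_pow_le {ν : ℕ → ℕ}
    (hν : Asymptotics.IsLittleO atTop (fun l : ℕ => (ν l : ℝ)) (fun l : ℕ => (l : ℝ)))
    (m : ℕ) {B : ℝ} (hB : 0 ≤ B) {γ : ℝ} (hγ : 0 < γ) :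
    ∀ᶠ l : ℕ in atTop, Fintype.card (MarginalIndex l m (ν l)) * B ^ ν l ≤ Real.exp (γ * l) := by
  set y := min 1 (γ / 2 / (m + 1))
  have hy : 0 < y := lt_min one_pos (by positivity)
  have hmy : m * y ≤ γ / 2 := by
    calc m * y ≤ (m + 1) * (γ / 2 / (m + 1)) := by
          gcongr
          exacts [by linarith, min_le_right _ _]
      _ = γ / 2 := by field_simp
  set C := max 1 (B / y)
  have hC : 0 ≤ Real.log C := Real.log_nonneg (le_max_left _ _)
  have hC0 : 0 < C := one_pos.trans_le (le_max_left _ _)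
  filter_upwards [hν.bound (c := γ / 2 / (Real.log C + 1)) (by positivity)] with l hl
  rw [Real.norm_natCast, Real.norm_natCast] at hl
  have hνlog : ν l * Real.log C ≤ γ / 2 * l := by
    calc ν l * Real.log C ≤ γ / 2 / (Real.log C + 1) * l * (Real.log C + 1) := by
          gcongr
          linarith
      _ = γ / 2 * l := by field_simp
  calc Fintype.card (MarginalIndex l m (ν l)) * B ^ ν l
      = Fintype.card (MarginalIndex l m (ν l)) * y ^ ν l * (B / y) ^ ν l := by
        rw [div_pow]
        field_simp
    _ ≤ Real.exp (l * (m * y)) * C ^ ν l := by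
        gcongr
        exacts [card_marginalIndex_mul_pow_le l m (ν l) hy.le (min_le_left _ _), le_max_right _ _]
    _ = Real.exp (l * (m * y) + ν l * Real.log C) := by
        rw [Real.exp_add, Real.exp_nat_mul (Real.log C), Real.exp_log hC0]
    _ ≤ Real.exp (γ * l) := by
        rw [Real.exp_le_exp]
        linarith [mul_le_mul_of_nonneg_left hmy (Nat.cast_nonneg (α := ℝ) l)]

variable {ι : Type*} [Fintype ι] {l d m : ℕ}

lemma restrictionError_le (ρ : Matrix (Fin d) (Fin d) ℂ) (a : Fin m → Matrix (Fin d) (Fin d) ℂ)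
    (ν : ℕ) (J : ι → Fin l → Fin m) (A : ι → Matrix (Fin l → Fin d) (Fin l → Fin d) ℂ) {c : ℝ}
    (hc : ∀ K : Finset (Fin l), K.card ≤ ν → ∀ j : K → Fin m,
      ‖restriction ρ J A K j - tensorProd (fun k : K => a (j k))‖ ≤ c) :
    restrictionError ρ a ν J A ≤ Fintype.card (MarginalIndex l m ν) * c := by
  rw [restrictionError, Finset.sum_subtype (p := fun K => K.card ≤ ν) _ (by simp),
    ← Fintype.sum_sigma', ← nsmul_eq_mul, ← Finset.card_univ]
  exact Finset.sum_le_card_nsmul _ _ c fun i _ => hc i.1.1 i.1.2 i.2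

lemma restrictionError_product {ρ : Matrix (Fin d) (Fin d) ℂ} (hρ1 : ρ.trace = 1)
    {a : Fin m → Matrix (Fin d) (Fin d) ℂ} (ha : ∑ i, a i = 1) (ν : ℕ) :
    restrictionError ρ a ν id (fun J : Fin l → Fin m => tensorProd fun k => a (J k)) = 0 := by
  refine Finset.sum_eq_zero fun K _ => Finset.sum_eq_zero fun j _ => ?_
  rw [restriction_product K hρ1 ha, sub_self, norm_zero]

end MarginalIndex

section Covering

variable {n ι : Type*} [Fintype n] [DecidableEq n] [Fintype ι]

lemma traceNorm_sum_mix_sub_le {N : ℕ} (hN : 0 < N) (X : Fin N → Matrix n n ℂ) {R : Matrix n n ℂ}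
    (hR : R.PosSemidef) (hR1 : R.trace.re ≤ 1) {ζ : ℝ} (hζ : 0 ≤ ζ) (s : Finset (Fin N)) :
    traceNorm (∑ μ ∈ s, (N : ℝ)⁻¹ • (X μ + ζ • R) - (N : ℝ)⁻¹ • ∑ μ ∈ s, X μ) ≤ ζ := by
  have hs : (s.card : ℝ) ≤ N := by simpa using s.card_le_univ
  have hmix : ∑ μ ∈ s, (N : ℝ)⁻¹ • (X μ + ζ • R) - (N : ℝ)⁻¹ • ∑ μ ∈ s, X μ =
      ((N : ℝ)⁻¹ * s.card * ζ) • R := by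
    rw [← Finset.smul_sum, Finset.sum_add_distrib, Finset.sum_const, smul_add,
      add_sub_cancel_left, ← Nat.cast_smul_eq_nsmul ℝ, mul_assoc, mul_smul, mul_smul]
  rw [hmix, traceNorm_smul, abs_of_nonneg (by positivity)]
  calc (N : ℝ)⁻¹ * s.card * ζ * traceNorm R ≤ (N : ℝ)⁻¹ * N * ζ * 1 := by
        gcongr
        exacts [traceNorm_nonneg R, (traceNorm_le_re_trace hR).trans hR1]
    _ = ζ := by field_simp

/-- An ensemble of positive operators `T j` of total trace `1` is approximated by the operators
`P j • Q (G j) Q`, where `P` is a probability distribution: the cutoffs `G j` and `Q` each cost at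
most `η` in trace, the `G j` have squared Hilbert–Schmidt norm at most `t`, and the projection `Q`
has rank at most `τ`. -/
structure IsTruncation (P : ι → ℝ) (T G : ι → Matrix n n ℂ) (Q : Matrix n n ℂ) (t τ η : ℝ) :
    Prop where
  weight_nonneg : ∀ j, 0 ≤ P j
  sum_weight : ∑ j, P j = 1
  trace_sum : (∑ j, T j).trace = 1
  posSemidef : ∀ j, (G j).PosSemidef
  posSemidef_sub : ∀ j, (T j - P j • G j).PosSemidef
  isStarProjection : IsStarProjection Q
  re_trace_sum_sub_le : (∑ j, (T j - P j • G j)).trace.re ≤ η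
  re_trace_sum_mul_le : ((∑ j, T j) * (1 - Q)).trace.re ≤ η
  hsSq_le : ∀ j, hsSq (G j) ≤ t
  re_trace_le : Q.trace.re ≤ τ

namespace IsTruncation

variable {P : ι → ℝ} {T G : ι → Matrix n n ℂ} {Q : Matrix n n ℂ} {t τ η : ℝ}

lemma posSemidef_smul (h : IsTruncation P T G Q t τ η) (j : ι) : (P j • G j).PosSemidef :=
  (h.posSemidef j).smul (h.weight_nonneg j)

lemma posSemidef_sum_sub_sum (h : IsTruncation P T G Q t τ η) (s : Finset ι) :
    (∑ j, T j - ∑ j ∈ s, P j • G j).PosSemidef := by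
  classical
  have hT (j : ι) : (T j).PosSemidef := by
    simpa only [sub_add_cancel] using (h.posSemidef_sub j).add (h.posSemidef_smul j)
  have hsplit : ∑ j, T j - ∑ j ∈ s, P j • G j =
      ∑ j ∈ s, (T j - P j • G j) + ∑ j ∈ sᶜ, T j := by
    rw [← Finset.sum_add_sum_compl s, Finset.sum_sub_distrib]
    abel
  rw [hsplit]
  exact (posSemidef_sum s fun j _ => h.posSemidef_sub j).add (posSemidef_sum sᶜ fun j _ => hT j)

lemma traceNorm_sum_sub_compression_le (h : IsTruncation P T G Q t τ η) (s : Finset ι) :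
    traceNorm (∑ j ∈ s, P j • G j - Q * (∑ j ∈ s, P j • G j) * Q) ≤ 2 * √η := by
  set R := ∑ j ∈ s, P j • G j
  have hR : R.PosSemidef := posSemidef_sum s fun j _ => h.posSemidef_smul j
  have hQη : (R * (1 - Q)).trace.re ≤ η := by
    have h₁ := re_trace_mul_nonneg (h.posSemidef_sum_sub_sum s)
      (posSemidef_of_isStarProjection h.isStarProjection.one_sub)
    rw [Matrix.sub_mul, Matrix.trace_sub, Complex.sub_re] at h₁
    linarith [h.re_trace_sum_mul_le]
  have hR1 : R.trace.re ≤ 1 := by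
    have h₁ := re_trace_nonneg (h.posSemidef_sum_sub_sum s)
    rw [Matrix.trace_sub, Complex.sub_re, h.trace_sum, Complex.one_re] at h₁
    linarith
  calc traceNorm (R - Q * R * Q) ≤ 2 * (√(R * (1 - Q)).trace.re * √R.trace.re) :=
        traceNorm_sub_compression_le hR h.isStarProjection
    _ ≤ 2 * (√η * 1) := by
        gcongr
        exact Real.sqrt_le_one.mpr hR1
    _ = 2 * √η := by rw [mul_one]

lemma traceNorm_sum_sub_le (h : IsTruncation P T G Q t τ η) (s : Finset ι) :
    traceNorm (∑ j ∈ s, T j - ∑ j ∈ s, P j • (Q * G j * Q)) ≤ 2 * √η + η := by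
  have hsplit : ∑ j ∈ s, T j - ∑ j ∈ s, P j • (Q * G j * Q) =
      (∑ j ∈ s, P j • G j - Q * (∑ j ∈ s, P j • G j) * Q) + ∑ j ∈ s, (T j - P j • G j) := by
    simp only [Finset.mul_sum, Finset.sum_mul, Matrix.mul_smul, Matrix.smul_mul,
      Finset.sum_sub_distrib]
    abel
  have hcut : traceNorm (∑ j ∈ s, (T j - P j • G j)) ≤ η := by
    refine (traceNorm_le_re_trace (posSemidef_sum s fun j _ => h.posSemidef_sub j)).trans
      (le_trans ?_ h.re_trace_sum_sub_le)
    simp only [Matrix.trace_sum, Complex.re_sum]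
    exact Finset.sum_le_sum_of_subset_of_nonneg (Finset.subset_univ s)
      fun j _ _ => re_trace_nonneg (h.posSemidef_sub j)
  rw [hsplit]
  exact (traceNorm_add_le _ _).trans (add_le_add (h.traceNorm_sum_sub_compression_le s) hcut)

lemma hsSq_compression_le (h : IsTruncation P T G Q t τ η) (j : ι) : hsSq (Q * G j * Q) ≤ t :=
  ((hsSq_mul_le_of_norm_le_one h.isStarProjection.norm_le _).trans
    (hsSq_mul_le_of_norm_le_one' h.isStarProjection.norm_le _)).trans (h.hsSq_le j)

lemma mul_compression (h : IsTruncation P T G Q t τ η) (j : ι) :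
    Q * (Q * G j * Q) = Q * G j * Q := by
  rw [← Matrix.mul_assoc, ← Matrix.mul_assoc, h.isStarProjection.isIdempotentElem.eq]

/-- The truncated operators carry nearly the whole trace, so `t` and `τ` cannot both be small. -/
lemma one_le (h : IsTruncation P T G Q t τ η) : 1 ≤ 2 * √η + η + √τ * √t := by
  have hterm (j : ι) : (Q * G j * Q).trace.re ≤ √τ * √t := by
    refine (Complex.re_le_norm _).trans ((norm_trace_le_traceNorm _).trans
      ((traceNorm_le_of_isStarProjection_mul h.isStarProjection (h.mul_compression j)).trans ?_))
    gcongr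
    exacts [h.re_trace_le, h.hsSq_compression_le j]
  have hkept : (∑ j, P j • (Q * G j * Q)).trace.re ≤ √τ * √t := by
    calc (∑ j, P j • (Q * G j * Q)).trace.re = ∑ j, P j * (Q * G j * Q).trace.re := by
          simp only [Matrix.trace_sum, Matrix.trace_smul, Complex.re_sum, Complex.real_smul,
            Complex.re_ofReal_mul]
      _ ≤ ∑ j, P j * (√τ * √t) :=
          Finset.sum_le_sum fun j _ => mul_le_mul_of_nonneg_left (hterm j) (h.weight_nonneg j)
      _ = √τ * √t := by rw [← Finset.sum_mul, h.sum_weight, one_mul]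
  have hlost := (Complex.re_le_norm _).trans
    ((norm_trace_le_traceNorm _).trans (h.traceNorm_sum_sub_le Finset.univ))
  rw [Matrix.trace_sub, h.trace_sum, Complex.sub_re, Complex.one_re] at hlost
  linarith

variable {I : Type*} [Fintype I]

lemma exists_traceNorm_sample_sub_le (h : IsTruncation P T G Q t τ η) (E : I → ι → Prop)
    [∀ i, DecidablePred (E i)] {N : ℕ} (hN : 0 < N) :
    ∃ J : Fin N → ι, ∀ i, traceNorm ((N : ℝ)⁻¹ • ∑ μ with E i (J μ), Q * G (J μ) * Q -
      ∑ j with E i j, P j • (Q * G j * Q)) ≤ √τ * √(Fintype.card I * t / N) := by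
  have hN' : (0 : ℝ) < N := Nat.cast_pos.mpr hN
  obtain ⟨J, hJ⟩ := exists_hsSq_sum_sub_le h.weight_nonneg h.sum_weight _
    h.hsSq_compression_le E N
  refine ⟨J, fun i => ?_⟩
  set D := ∑ μ with E i (J μ), Q * G (J μ) * Q -
    (N : ℝ) • ∑ j with E i j, P j • (Q * G j * Q) with hD
  have hQD : Q * ((N : ℝ)⁻¹ • D) = (N : ℝ)⁻¹ • D := by
    simp only [hD, Matrix.mul_smul, Matrix.mul_sub, Finset.mul_sum, h.mul_compression]
  calc traceNorm ((N : ℝ)⁻¹ • ∑ μ with E i (J μ), Q * G (J μ) * Q -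
        ∑ j with E i j, P j • (Q * G j * Q)) = traceNorm ((N : ℝ)⁻¹ • D) := by
        rw [hD, smul_sub, inv_smul_smul₀ hN'.ne']
    _ ≤ √Q.trace.re * √(hsSq ((N : ℝ)⁻¹ • D)) :=
        traceNorm_le_of_isStarProjection_mul h.isStarProjection hQD
    _ ≤ √τ * √(Fintype.card I * t / N) := by
        gcongr
        · exact h.re_trace_le
        · calc hsSq ((N : ℝ)⁻¹ • D) ≤ (N : ℝ)⁻¹ ^ 2 * (N * (Fintype.card I * t)) := by
                rw [hsSq_smul]
                gcongr
                exact hJ i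
            _ = Fintype.card I * t / N := by field_simp

/-- A small multiple of `∑ j, T j` is mixed into every sample to make their sum positive
definite. -/
lemma exists_covering (h : IsTruncation P T G Q t τ η) (hT : (∑ j, T j).PosDef)
    (E : I → ι → Prop) [∀ i, DecidablePred (E i)] {N : ℕ} (hN : 0 < N) {e : ℝ}
    (he : √τ * √(Fintype.card I * t / N) + (2 * √η + η) < e) :
    ∃ (J : Fin N → ι) (B : Fin N → Matrix n n ℂ), (∀ μ, (B μ).PosSemidef) ∧ (∑ μ, B μ).PosDef ∧
      ∀ i, traceNorm (∑ μ with E i (J μ), B μ - ∑ j with E i j, T j) ≤ e := by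
  obtain ⟨J, hJ⟩ := h.exists_traceNorm_sample_sub_le E hN
  obtain ⟨ζ, hζ, hζe⟩ : ∃ ζ, 0 < ζ ∧ √τ * √(Fintype.card I * t / N) + ζ + (2 * √η + η) = e :=
    ⟨_, sub_pos.mpr he, by ring⟩
  set R := ∑ j, T j
  have hR1 : R.trace.re = 1 := by rw [h.trace_sum, Complex.one_re]
  set X : ι → Matrix n n ℂ := fun j => Q * G j * Q
  have hX (j : ι) : (X j).PosSemidef := by
    have hQ := h.isStarProjection.isSelfAdjoint.star_eq
    rw [star_eq_conjTranspose] at hQ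
    simpa only [hQ] using (h.posSemidef j).mul_mul_conjTranspose_same Q
  have hN' : (0 : ℝ) < N := Nat.cast_pos.mpr hN
  refine ⟨J, fun μ => (N : ℝ)⁻¹ • (X (J μ) + ζ • R), fun μ => ?_, ?_, fun i => ?_⟩
  · exact ((hX _).add (hT.posSemidef.smul hζ.le)).smul (inv_nonneg.mpr hN'.le)
  · rw [← Finset.smul_sum, Finset.sum_add_distrib, Finset.sum_const, Finset.card_univ,
      Fintype.card_fin, ← Nat.cast_smul_eq_nsmul ℝ]
    exact (PosDef.posSemidef_add (posSemidef_sum _ fun μ _ => hX _)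
      ((hT.smul hζ).smul hN')).smul (inv_pos.mpr hN')
  · set s : Finset (Fin N) := {μ | E i (J μ)}
    have hsplit : ∑ μ ∈ s, (N : ℝ)⁻¹ • (X (J μ) + ζ • R) - ∑ j with E i j, T j =
        ((N : ℝ)⁻¹ • ∑ μ ∈ s, X (J μ) - ∑ j with E i j, P j • X j) +
        (∑ μ ∈ s, (N : ℝ)⁻¹ • (X (J μ) + ζ • R) - (N : ℝ)⁻¹ • ∑ μ ∈ s, X (J μ)) +
        -(∑ j with E i j, T j - ∑ j with E i j, P j • X j) := by abel
    have hmix := traceNorm_sum_mix_sub_le hN (X ∘ J) hT.posSemidef hR1.le hζ.le s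
    rw [hsplit, ← hζe]
    refine (traceNorm_add_le _ _).trans (add_le_add ((traceNorm_add_le _ _).trans
      (add_le_add (hJ i) hmix)) ?_)
    rw [traceNorm_neg]
    exact h.traceNorm_sum_sub_le _

end IsTruncation

lemma exists_isPOVM_conj {N : ℕ} {B : Fin N → Matrix n n ℂ} (hB : ∀ μ, (B μ).PosSemidef)
    (hsum : (∑ μ, B μ).PosDef) :
    ∃ (h : Matrix n n ℂ) (A : Fin N → Matrix n n ℂ), h.PosSemidef ∧ h * h = ∑ μ, B μ ∧
      IsPOVM A ∧ ∀ μ, h * A μ * h = B μ := by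
  open scoped MatrixOrder in
  set h := CFC.sqrt (∑ μ, B μ)
  have hh : h.PosSemidef := nonneg_iff_posSemidef.mp (CFC.sqrt_nonneg _)
  have hhh : h * h = ∑ μ, B μ :=
    CFC.sqrt_mul_sqrt_self _ (nonneg_iff_posSemidef.mpr hsum.posSemidef)
  have hdet : IsUnit h.det := by
    rw [← isUnit_iff_isUnit_det]
    exact (CFC.isUnit_sqrt_iff _ (nonneg_iff_posSemidef.mpr hsum.posSemidef)).mpr hsum.isUnit
  have hinv : h⁻¹ᴴ = h⁻¹ := by rw [conjTranspose_nonsing_inv, hh.1.eq]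
  refine ⟨h, fun μ => h⁻¹ * B μ * h⁻¹, hh, hhh, ⟨fun μ => ?_, ?_⟩, fun μ => ?_⟩
  · simpa only [hinv] using (hB μ).mul_mul_conjTranspose_same h⁻¹
  · rw [← Finset.sum_mul, ← Finset.mul_sum, ← hhh, ← Matrix.mul_assoc, nonsing_inv_mul _ hdet,
      Matrix.one_mul, mul_nonsing_inv _ hdet]
  · simp only [← Matrix.mul_assoc, mul_nonsing_inv _ hdet, Matrix.one_mul]
    rw [Matrix.mul_assoc, nonsing_inv_mul _ hdet, Matrix.mul_one]

lemma IsPOVM.norm_sum_le_one {A : ι → Matrix n n ℂ} (hA : IsPOVM A)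
    (s : Finset ι) : ‖∑ μ ∈ s, A μ‖ ≤ 1 := by
  classical
  refine norm_le_one_of_posSemidef (posSemidef_sum s fun μ _ => hA.1 μ) ?_
  rw [← hA.2, ← Finset.sum_add_sum_compl s, add_sub_cancel_left]
  exact posSemidef_sum sᶜ fun μ _ => hA.1 μ

lemma exists_isPOVM_of_covering {I : Type*} {N : ℕ} {J : Fin N → ι} {B : Fin N → Matrix n n ℂ}
    (hB : ∀ μ, (B μ).PosSemidef) (hsum : (∑ μ, B μ).PosDef) {r : Matrix n n ℂ}
    (hr : r.PosSemidef) (hr1 : hsSq r ≤ 1) {S : ι → Matrix n n ℂ} (hS : ∑ j, S j = 1)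
    (E : I → ι → Prop) [∀ i, DecidablePred (E i)] {i₀ : I} (hi₀ : ∀ j, E i₀ j) {e : ℝ}
    (he1 : e ≤ 1)
    (he : ∀ i, traceNorm (∑ μ with E i (J μ), B μ - ∑ j with E i j, r * S j * r) ≤ e) :
    ∃ A : Fin N → Matrix n n ℂ, IsPOVM A ∧
      ∀ i, traceNorm (r * (∑ μ with E i (J μ), A μ - ∑ j with E i j, S j) * r) ≤
        3 * √e + e := by
  obtain ⟨h, A, hh, hhh, hA, hAB⟩ := exists_isPOVM_conj hB hsum
  refine ⟨A, hA, fun i => ?_⟩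
  have htotal : traceNorm (r * r - h * h) ≤ e := by
    have h₀ := he i₀
    simp only [hi₀, Finset.filter_true] at h₀
    rwa [← Finset.sum_mul, ← Finset.mul_sum, hS, Matrix.mul_one, ← hhh, ← traceNorm_neg,
      neg_sub] at h₀
  set A' := ∑ μ with E i (J μ), A μ with hA'
  have hsplit : r * (A' - ∑ j with E i j, S j) * r =
      (r * A' * r - h * A' * h) +
        (∑ μ with E i (J μ), B μ - ∑ j with E i j, r * S j * r) := by
    simp only [← hAB, ← Finset.sum_mul, ← Finset.mul_sum, Matrix.mul_sub, Matrix.sub_mul, ← hA']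
    abel
  rw [hsplit]
  refine (traceNorm_add_le _ _).trans (add_le_add ?_ (he i))
  refine (traceNorm_sandwich_sub_le hr hh (hA.norm_sum_le_one _) hr1 (htotal.trans he1)).trans ?_
  gcongr

lemma IsTruncation.exists_isPOVM {I : Type*} [Fintype I] {P : ι → ℝ} {S G : ι → Matrix n n ℂ}
    {r Q : Matrix n n ℂ} {t τ η : ℝ} (hr : r.PosDef) (hS : ∑ j, S j = 1)
    (h : IsTruncation P (fun j => r * S j * r) G Q t τ η) (E : I → ι → Prop)
    [∀ i, DecidablePred (E i)] {i₀ : I} (hi₀ : ∀ j, E i₀ j) {N : ℕ} (hN : 0 < N) {e : ℝ}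
    (he : √τ * √(Fintype.card I * t / N) + (2 * √η + η) < e) (he1 : e ≤ 1) :
    ∃ (J : Fin N → ι) (A : Fin N → Matrix n n ℂ), IsPOVM A ∧
      ∀ i, traceNorm (r * (∑ μ with E i (J μ), A μ - ∑ j with E i j, S j) * r) ≤
        3 * √e + e := by
  have hrr : ∑ j, r * S j * r = rᴴ * r := by
    rw [← Finset.sum_mul, ← Finset.mul_sum, hS, Matrix.mul_one, hr.1.eq]
  have hrrpos : (∑ j, r * S j * r).PosDef := by
    rw [hrr]
    exact (posSemidef_conjTranspose_mul_self r).posDef_iff_isUnit.mpr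
      (hr.isUnit.star.mul hr.isUnit)
  have hr1 : hsSq r = 1 := by
    have htr := h.trace_sum
    rw [hrr, trace_conjTranspose_mul_self] at htr
    exact_mod_cast htr
  obtain ⟨J, B, hB, hBsum, hBe⟩ := h.exists_covering hrrpos E hN he
  obtain ⟨A, hA, hAe⟩ := exists_isPOVM_of_covering hB hBsum hr.posSemidef hr1.le hS E hi₀ he1 hBe
  exact ⟨J, A, hA, hAe⟩

end Covering

section ProductPOVM

variable {d m l : ℕ}

lemma posDef_tensorProd {κ : Type*} [Fintype κ] {B : κ → Matrix (Fin d) (Fin d) ℂ}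
    (hB : ∀ k, (B k).PosDef) : (tensorProd B).PosDef := by
  classical
  refine (posSemidef_tensorProd fun k => (hB k).posSemidef).posDef_iff_isUnit.mpr
    (IsUnit.of_mul_eq_one (tensorProd fun k => (B k)⁻¹) ?_)
  rw [← tensorProd_mul, ← tensorProd_one]
  congr! with k
  exact mul_nonsing_inv _ ((isUnit_iff_isUnit_det _).mp (hB k).isUnit)

lemma isPOVM_tensorProd {a : Fin m → Matrix (Fin d) (Fin d) ℂ} (ha : IsPOVM a) :
    IsPOVM fun J : Fin l → Fin m => tensorProd fun k => a (J k) := by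
  refine ⟨fun J => posSemidef_tensorProd fun k => ha.1 (J k), ?_⟩
  rw [← Fintype.piFinset_univ, sum_piFinset_tensorProd, ha.2, tensorProd_one]

lemma restrictionError_comp_equiv {ι ι' : Type*} [Fintype ι] [Fintype ι'] (e : ι ≃ ι')
    (ρ : Matrix (Fin d) (Fin d) ℂ) (a : Fin m → Matrix (Fin d) (Fin d) ℂ) (ν : ℕ)
    (J : ι' → Fin l → Fin m) (A : ι' → Matrix (Fin l → Fin d) (Fin l → Fin d) ℂ) :
    restrictionError ρ a ν (J ∘ e) (A ∘ e) = restrictionError ρ a ν J A := by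
  refine Finset.sum_congr rfl fun K _ => Finset.sum_congr rfl fun j _ => ?_
  simp only [restriction, Finset.sum_filter, Function.comp_apply]
  rw [e.sum_comp fun μ => if ∀ k : K, J μ k = j k then A μ else 0]

lemma exists_isPOVM_restrictionError_eq_zero {ρ : Matrix (Fin d) (Fin d) ℂ} (hρ1 : ρ.trace = 1)
    {a : Fin m → Matrix (Fin d) (Fin d) ℂ} (ha : IsPOVM a) (l ν : ℕ) :
    ∃ (M : ℕ) (J : Fin M → Fin l → Fin m)
      (A : Fin M → Matrix (Fin l → Fin d) (Fin l → Fin d) ℂ),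
      IsPOVM A ∧ restrictionError ρ a ν J A = 0 := by
  set e := (Fintype.equivFin (Fin l → Fin m)).symm
  obtain ⟨hpos, hsum⟩ := isPOVM_tensorProd (l := l) ha
  refine ⟨_, id ∘ e, (fun J : Fin l → Fin m => tensorProd fun k => a (J k)) ∘ e,
    ⟨fun μ => hpos (e μ), (e.sum_comp _).trans hsum⟩, ?_⟩
  rw [restrictionError_comp_equiv, restrictionError_product hρ1 ha.2]

lemma restriction_sub_tensorProd {N : ℕ} {ρ : Matrix (Fin d) (Fin d) ℂ} (hρ1 : ρ.trace = 1)
    {a : Fin m → Matrix (Fin d) (Fin d) ℂ} (ha : ∑ i, a i = 1) (J : Fin N → Fin l → Fin m)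
    (A : Fin N → Matrix (Fin l → Fin d) (Fin l → Fin d) ℂ) (K : Finset (Fin l)) (j : K → Fin m) :
    restriction ρ J A K j - tensorProd (fun k : K => a (j k)) =
      partialTrace K (tensorProd (fun k => if k ∈ K then 1 else ρ) *
        (∑ μ with ∀ k : K, J μ k = j k, A μ -
          ∑ J' : Fin l → Fin m with ∀ k : K, J' k = j k, tensorProd fun k => a (J' k))) := by
  rw [← restriction_product K hρ1 ha, restriction, restriction, Matrix.mul_sub]
  ext x y
  simp only [partialTrace, of_apply, Matrix.sub_apply, Finset.sum_sub_distrib, id]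

lemma IsTruncation.exists_restrictionError_le {w : Matrix (Fin d) (Fin d) ℂ} (hw : w.PosDef)
    (hw1 : (w * w).trace = 1) {a : Fin m → Matrix (Fin d) (Fin d) ℂ} (ha : IsPOVM a)
    {P : (Fin l → Fin m) → ℝ} {G : (Fin l → Fin m) → Matrix (Fin l → Fin d) (Fin l → Fin d) ℂ}
    {Q : Matrix (Fin l → Fin d) (Fin l → Fin d) ℂ} {t τ η : ℝ}
    (h : IsTruncation P (fun J => tensorProd (fun _ => w) * (tensorProd fun k => a (J k)) *
      tensorProd fun _ => w) G Q t τ η) (ν : ℕ) {N : ℕ} (hN : 0 < N) {e : ℝ}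
    (he : √τ * √(Fintype.card (MarginalIndex l m ν) * t / N) + (2 * √η + η) < e) (he1 : e ≤ 1) :
    ∃ (J : Fin N → Fin l → Fin m) (A : Fin N → Matrix (Fin l → Fin d) (Fin l → Fin d) ℂ),
      IsPOVM A ∧ restrictionError (w * w) a ν J A ≤
        Fintype.card (MarginalIndex l m ν) * (max 1 (‖w⁻¹‖ ^ 2) ^ ν * (3 * √e + e)) := by
  let i₀ : MarginalIndex l m ν := ⟨⟨∅, by simp⟩, fun k => absurd k.2 (Finset.notMem_empty _)⟩
  obtain ⟨J, A, hA, hAe⟩ := h.exists_isPOVM (posDef_tensorProd fun _ => hw)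
    (isPOVM_tensorProd ha).2 (fun (i : MarginalIndex l m ν) J => ∀ k : i.1.1, J k = i.2 k)
    (i₀ := i₀) (fun _ k => absurd k.2 (Finset.notMem_empty _)) hN he he1
  refine ⟨J, A, hA, restrictionError_le _ a ν J A fun K hK j => ?_⟩
  have hKj := hAe ⟨⟨K, hK⟩, j⟩
  rw [restriction_sub_tensorProd hw1 ha.2]
  refine (norm_partialTrace_le K hw.isUnit _).trans ?_
  have hbase : (‖w⁻¹‖ ^ 2) ^ K.card ≤ max 1 (‖w⁻¹‖ ^ 2) ^ ν :=
    (pow_le_pow_left₀ (by positivity) (le_max_right 1 _) _).trans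
      (pow_le_pow_right₀ (le_max_left 1 _) hK)
  exact mul_le_mul hbase hKj (traceNorm_nonneg _) (by positivity)

end ProductPOVM

section ProductSums

variable {κ β : Type*} [Fintype κ] [DecidableEq κ] [Fintype β]

lemma sum_prod_apply (f : κ → β → ℝ) : ∑ x : κ → β, ∏ k, f k (x k) = ∏ k, ∑ b, f k b := by
  rw [Finset.prod_univ_sum, Fintype.piFinset_univ]

lemma sum_prod_apply_eq_one {f : β → ℝ} (hf : ∑ b, f b = 1) :
    ∑ x : κ → β, ∏ k, f (x k) = 1 := by
  rw [sum_prod_apply fun _ => f, hf, Finset.prod_const_one]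

end ProductSums

section Spectrum

variable {n : Type*} [Fintype n] [DecidableEq n]

lemma hsSq_conjDiag (U : unitaryGroup n ℂ) (f : n → ℝ) :
    hsSq (conjDiag U f) = ∑ i, f i * f i := by
  have h := trace_conjTranspose_mul_self (conjDiag U f)
  rw [(isHermitian_conjDiag U f).eq, ← conjDiag_mul, trace_conjDiag] at h
  exact (Complex.ofReal_injective h).symm

lemma isStarProjection_conjDiag_indicator (U : unitaryGroup n ℂ) (s : Set n) :
    IsStarProjection (conjDiag U (s.indicator 1)) where
  isIdempotentElem := by
    rw [IsIdempotentElem, ← conjDiag_mul, ← Set.inter_indicator_one, Set.inter_self]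
  isSelfAdjoint := isHermitian_conjDiag U _

lemma entropy_eq_sum_negMulLog {A : Matrix n n ℂ} (hA : A.IsHermitian) :
    entropy A = (∑ i, Real.negMulLog (hA.eigenvalues i)) / Real.log 2 := by
  rw [entropy, cfc_eq_conjDiag hA, trace_conjDiag, Complex.ofReal_re]
  rfl

end Spectrum

/-- A state of full rank together with a POVM that measures it. -/
structure MeasuredState (d m : ℕ) where
  state : Matrix (Fin d) (Fin d) ℂ
  povm : Fin m → Matrix (Fin d) (Fin d) ℂ
  posDef : state.PosDef
  trace_eq_one : state.trace = 1
  isPOVM : IsPOVM povm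

namespace MeasuredState

variable {d m : ℕ} (S : MeasuredState d m)

/-- The eigenvalues of the state. -/
def eigenvalue : Fin d → ℝ := S.posDef.1.eigenvalues

/-- An eigenbasis of the state. -/
def basis : unitaryGroup (Fin d) ℂ := S.posDef.1.eigenvectorUnitary

/-- The square root of the state. -/
def sqrtState : Matrix (Fin d) (Fin d) ℂ := cfc Real.sqrt S.state

/-- The probabilities `λⱼ` of the outcomes. -/
def outcomeProb (j : Fin m) : ℝ := prob S.state (S.povm j)

lemma state_eq : S.state = conjDiag S.basis S.eigenvalue := eq_conjDiag_eigenvalues _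

lemma sqrtState_eq : S.sqrtState = conjDiag S.basis (Real.sqrt ∘ S.eigenvalue) :=
  cfc_eq_conjDiag S.posDef.1 Real.sqrt

lemma eigenvalue_pos (i : Fin d) : 0 < S.eigenvalue i := S.posDef.eigenvalues_pos i

lemma sum_eigenvalue : ∑ i, S.eigenvalue i = 1 := by
  have h := trace_conjDiag S.basis S.eigenvalue
  rw [← state_eq, S.trace_eq_one] at h
  exact_mod_cast h.symm

lemma sqrtState_mul_self : S.sqrtState * S.sqrtState = S.state := by
  rw [sqrtState_eq, ← conjDiag_mul, state_eq]
  exact congrArg _ (funext fun i => Real.mul_self_sqrt (S.eigenvalue_pos i).le)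

lemma posSemidef_sqrtState : S.sqrtState.PosSemidef := by
  rw [sqrtState_eq]
  exact posSemidef_conjDiag _ fun i => Real.sqrt_nonneg _

lemma posDef_sqrtState : S.sqrtState.PosDef := by
  refine S.posSemidef_sqrtState.posDef_iff_isUnit.mpr ((Commute.refl _).isUnit_mul_iff.mp ?_).1
  rw [sqrtState_mul_self]
  exact S.posDef.isUnit

lemma posSemidef_sqrtState_mul_mul (j : Fin m) :
    (S.sqrtState * S.povm j * S.sqrtState).PosSemidef := by
  simpa only [S.posSemidef_sqrtState.1.eq] using
    (S.isPOVM.1 j).mul_mul_conjTranspose_same S.sqrtState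

lemma trace_sqrtState_mul_mul (j : Fin m) :
    (S.sqrtState * S.povm j * S.sqrtState).trace = (S.outcomeProb j : ℂ) := by
  have him := (Complex.le_def.mp (S.posSemidef_sqrtState_mul_mul j).trace_nonneg).2
  rw [trace_mul_comm, ← Matrix.mul_assoc, sqrtState_mul_self] at him ⊢
  exact Complex.ext rfl him.symm

lemma outcomeProb_nonneg (j : Fin m) : 0 ≤ S.outcomeProb j := by
  simpa only [trace_sqrtState_mul_mul, Complex.ofReal_re] using
    re_trace_nonneg (S.posSemidef_sqrtState_mul_mul j)

lemma sum_outcomeProb : ∑ j, S.outcomeProb j = 1 := by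
  simp only [outcomeProb, prob, ← Complex.re_sum, ← Matrix.trace_sum, ← Finset.mul_sum,
    S.isPOVM.2, Matrix.mul_one, S.trace_eq_one, Complex.one_re]

lemma posSemidef_canonicalState (j : Fin m) : (canonicalState S.state (S.povm j)).PosSemidef := by
  rw [canonicalState, Complex.coe_smul]
  exact (S.posSemidef_sqrtState_mul_mul j).smul (inv_nonneg.mpr (S.outcomeProb_nonneg j))

lemma outcomeProb_smul_canonicalState (j : Fin m) :
    S.outcomeProb j • canonicalState S.state (S.povm j) =
      S.sqrtState * S.povm j * S.sqrtState := by
  rw [canonicalState, Complex.coe_smul, ← outcomeProb, ← sqrtState]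
  rcases eq_or_ne (S.outcomeProb j) 0 with h₀ | h₀
  · have htr := S.trace_sqrtState_mul_mul j
    rw [h₀, Complex.ofReal_zero, (S.posSemidef_sqrtState_mul_mul j).trace_eq_zero_iff] at htr
    rw [htr, smul_zero, smul_zero]
  · rw [smul_inv_smul₀ h₀]

/-- The eigenvalues of the states of the canonical ensemble, that is, the conditional
probabilities of their eigenvectors given the outcome; they vanish if the outcome has
probability `0`. -/
def condProb (j : Fin m) : Fin d → ℝ := (S.posSemidef_canonicalState j).1.eigenvalues

/-- Eigenbases of the states of the canonical ensemble. -/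
def condBasis (j : Fin m) : unitaryGroup (Fin d) ℂ :=
  (S.posSemidef_canonicalState j).1.eigenvectorUnitary

lemma condProb_nonneg (j : Fin m) (i : Fin d) : 0 ≤ S.condProb j i :=
  (S.posSemidef_canonicalState j).eigenvalues_nonneg i

lemma canonicalState_eq (j : Fin m) : canonicalState S.state (S.povm j) =
    conjDiag (S.condBasis j) (S.condProb j) := eq_conjDiag_eigenvalues _

lemma sqrtState_mul_mul_eq (j : Fin m) : S.sqrtState * S.povm j * S.sqrtState =
    conjDiag (S.condBasis j) (S.outcomeProb j • S.condProb j) := by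
  rw [conjDiag_smul, ← canonicalState_eq, outcomeProb_smul_canonicalState]

lemma outcomeProb_mul_sum_condProb (j : Fin m) :
    S.outcomeProb j * ∑ i, S.condProb j i = S.outcomeProb j := by
  have h := S.trace_sqrtState_mul_mul j
  rw [sqrtState_mul_mul_eq, trace_conjDiag] at h
  rw [Finset.mul_sum]
  exact_mod_cast h

lemma sum_condProb_le_one (j : Fin m) : ∑ i, S.condProb j i ≤ 1 := by
  have h := trace_conjDiag (S.condBasis j) (S.condProb j)
  rw [← canonicalState_eq, canonicalState, Matrix.trace_smul, ← sqrtState,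
    trace_sqrtState_mul_mul, ← outcomeProb, smul_eq_mul, ← Complex.ofReal_mul] at h
  exact (Complex.ofReal_injective h).symm.trans_le inv_mul_le_one

/-- The entropy of the state in natural units. -/
def stateEntropy : ℝ := ∑ i, Real.negMulLog (S.eigenvalue i)

/-- The mean entropy of the canonical ensemble in natural units. -/
def meanEntropy : ℝ := ∑ j, S.outcomeProb j * ∑ i, Real.negMulLog (S.condProb j i)

lemma entropyDefect_eq :
    entropyDefect S.state S.povm = (S.stateEntropy - S.meanEntropy) / Real.log 2 := by
  have hstate : entropy S.state = S.stateEntropy / Real.log 2 :=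
    entropy_eq_sum_negMulLog S.posDef.1
  have hcond (j : Fin m) : entropy (canonicalState S.state (S.povm j)) =
      (∑ i, Real.negMulLog (S.condProb j i)) / Real.log 2 := entropy_eq_sum_negMulLog _
  simp only [entropyDefect, hstate, hcond, sub_div, meanEntropy, Finset.sum_div,
    mul_div_assoc]
  rfl

section Truncation

variable {l : ℕ} (t τ : ℝ) (J : Fin l → Fin m)

/-- The probability of a sequence of outcomes in `l` measurements. -/
def seqProb : ℝ := ∏ k, S.outcomeProb (J k)

/-- The eigenvalues of the tensor product of the canonical states of a sequence of outcomes. -/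
def condSeqProb (x : Fin l → Fin d) : ℝ := ∏ k, S.condProb (J k) (x k)

/-- The tensor product of the canonical states of a sequence of outcomes, with the eigenvalues
above `t` replaced by `0`. -/
def cutoff : Matrix (Fin l → Fin d) (Fin l → Fin d) ℂ :=
  conjDiag (tensorUnitary fun k => S.condBasis (J k))
    ({x | S.condSeqProb J x ≤ t}.indicator (S.condSeqProb J))

variable (l) in
/-- The spectral projection of the `l`-fold tensor power of the state to the eigenvalues that are
at least `τ⁻¹`. -/
def typicalProj : Matrix (Fin l → Fin d) (Fin l → Fin d) ℂ :=
  conjDiag (tensorUnitary fun _ => S.basis)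
    ({x | 1 ≤ τ * ∏ k, S.eigenvalue (x k)}.indicator 1)

lemma seqProb_nonneg : 0 ≤ S.seqProb J := Finset.prod_nonneg fun _ _ => S.outcomeProb_nonneg _

lemma sum_seqProb : ∑ J : Fin l → Fin m, S.seqProb J = 1 := sum_prod_apply_eq_one S.sum_outcomeProb

lemma condSeqProb_nonneg : 0 ≤ S.condSeqProb J :=
  fun _ => Finset.prod_nonneg fun _ _ => S.condProb_nonneg _ _

lemma sum_condSeqProb_le_one : ∑ x, S.condSeqProb J x ≤ 1 :=
  (sum_prod_apply fun k => S.condProb (J k)).trans_le <| Finset.prod_le_one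
    (fun _ _ => Finset.sum_nonneg fun _ _ => S.condProb_nonneg _ _)
    fun _ _ => S.sum_condProb_le_one _

/-- The product ensemble `√ρ^{⊗l} (⨂ₖ a_{Jₖ}) √ρ^{⊗l}` of the sequences of outcomes. -/
def ensemble : Matrix (Fin l → Fin d) (Fin l → Fin d) ℂ :=
  tensorProd (fun _ => S.sqrtState) * (tensorProd fun k => S.povm (J k)) *
    tensorProd fun _ => S.sqrtState

lemma ensemble_eq : S.ensemble J =
    conjDiag (tensorUnitary fun k => S.condBasis (J k)) (S.seqProb J • S.condSeqProb J) := by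
  rw [ensemble, ← tensorProd_mul, ← tensorProd_mul]
  simp only [sqrtState_mul_mul_eq, tensorProd_conjDiag, Pi.smul_apply, smul_eq_mul,
    Finset.prod_mul_distrib]
  rfl

lemma sum_ensemble : ∑ J : Fin l → Fin m, S.ensemble J =
    conjDiag (tensorUnitary fun _ => S.basis) fun x => ∏ k, S.eigenvalue (x k) := by
  simp only [ensemble]
  rw [← Finset.sum_mul, ← Finset.mul_sum, (isPOVM_tensorProd S.isPOVM).2, Matrix.mul_one,
    ← tensorProd_mul, sqrtState_mul_self, ← tensorProd_conjDiag, ← state_eq]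

lemma trace_sum_ensemble : (∑ J : Fin l → Fin m, S.ensemble J).trace = 1 := by
  rw [sum_ensemble, trace_conjDiag, sum_prod_apply_eq_one S.sum_eigenvalue, Complex.ofReal_one]

lemma posSemidef_cutoff : (S.cutoff t J).PosSemidef :=
  posSemidef_conjDiag _ (Set.indicator_nonneg fun x _ => S.condSeqProb_nonneg J x)

lemma ensemble_sub_cutoff : S.ensemble J - S.seqProb J • S.cutoff t J =
    conjDiag (tensorUnitary fun k => S.condBasis (J k))
      (S.seqProb J • {x | t < S.condSeqProb J x}.indicator (S.condSeqProb J)) := by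
  have hcompl : {x | t < S.condSeqProb J x} = {x | S.condSeqProb J x ≤ t}ᶜ := by
    ext x
    simp only [Set.mem_ofPred_eq, Set.mem_compl_iff, not_le]
  rw [ensemble_eq, cutoff, ← conjDiag_smul, ← conjDiag_sub, hcompl, Set.indicator_compl, smul_sub]

lemma posSemidef_ensemble_sub_cutoff :
    (S.ensemble J - S.seqProb J • S.cutoff t J).PosSemidef := by
  rw [ensemble_sub_cutoff]
  exact posSemidef_conjDiag _ (smul_nonneg (S.seqProb_nonneg J)
    (Set.indicator_nonneg fun x _ => S.condSeqProb_nonneg J x))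

lemma re_trace_sum_ensemble_sub_cutoff :
    (∑ J : Fin l → Fin m, (S.ensemble J - S.seqProb J • S.cutoff t J)).trace.re =
      ∑ z : Fin l → Fin m × Fin d with t < ∏ k, S.condProb (z k).1 (z k).2,
        ∏ k, (S.outcomeProb (z k).1 * S.condProb (z k).1 (z k).2) := by
  classical
  rw [Matrix.trace_sum, Complex.re_sum, Finset.sum_filter,
    ← (Equiv.arrowProdEquivProdArrow (Fin l) (fun _ => Fin m) (fun _ => Fin d)).symm.sum_comp,
    Fintype.sum_prod_type]
  refine Finset.sum_congr rfl fun J _ => ?_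
  rw [ensemble_sub_cutoff, trace_conjDiag, Complex.ofReal_re]
  refine Finset.sum_congr rfl fun x _ => ?_
  simp only [Pi.smul_apply, Set.indicator_apply, Set.mem_ofPred_eq, smul_eq_mul, mul_ite, mul_zero,
    Finset.prod_mul_distrib]
  rfl

lemma re_trace_sum_ensemble_mul_one_sub_typicalProj :
    ((∑ J : Fin l → Fin m, S.ensemble J) * (1 - S.typicalProj l τ)).trace.re =
      ∑ x : Fin l → Fin d with τ * ∏ k, S.eigenvalue (x k) < 1, ∏ k, S.eigenvalue (x k) := by
  rw [sum_ensemble, typicalProj, ← conjDiag_one, ← conjDiag_sub, ← conjDiag_mul,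
    trace_conjDiag, Complex.ofReal_re, Finset.sum_filter]
  refine Finset.sum_congr rfl fun x _ => ?_
  rcases lt_or_ge (τ * ∏ k, S.eigenvalue (x k)) 1 with hx | hx
  · simp [Set.indicator, hx, hx.not_ge]
  · simp [Set.indicator, hx, hx.not_gt]

variable {t τ}

lemma hsSq_cutoff_le (ht : 0 ≤ t) : hsSq (S.cutoff t J) ≤ t := by
  rw [cutoff, hsSq_conjDiag]
  calc ∑ x, {x | S.condSeqProb J x ≤ t}.indicator (S.condSeqProb J) x *
        {x | S.condSeqProb J x ≤ t}.indicator (S.condSeqProb J) x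
      ≤ ∑ x, t * S.condSeqProb J x := Finset.sum_le_sum fun x _ => by
        have hx := S.condSeqProb_nonneg J x
        refine mul_le_mul (Set.indicator_apply_le' id fun _ => ht)
          (Set.indicator_le_self' (fun _ _ => hx) x) ?_ ht
        exact Set.indicator_nonneg (fun y _ => S.condSeqProb_nonneg J y) x
    _ ≤ t := by
        rw [← Finset.mul_sum]
        exact mul_le_of_le_one_right ht (S.sum_condSeqProb_le_one J)

lemma re_trace_typicalProj_le (hτ : 0 ≤ τ) : (S.typicalProj l τ).trace.re ≤ τ := by
  rw [typicalProj, trace_conjDiag, Complex.ofReal_re]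
  calc ∑ x, {x : Fin l → Fin d | 1 ≤ τ * ∏ k, S.eigenvalue (x k)}.indicator 1 x
      ≤ ∑ x : Fin l → Fin d, τ * ∏ k, S.eigenvalue (x k) := Finset.sum_le_sum fun x _ =>
        Set.indicator_apply_le' id fun _ =>
          mul_nonneg hτ (Finset.prod_nonneg fun k _ => (S.eigenvalue_pos (x k)).le)
    _ = τ := by rw [← Finset.mul_sum, sum_prod_apply_eq_one S.sum_eigenvalue, mul_one]

lemma isTruncation (ht : 0 ≤ t) (hτ : 0 ≤ τ) {η : ℝ}
    (hcut : ∑ z : Fin l → Fin m × Fin d with t < ∏ k, S.condProb (z k).1 (z k).2,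
      ∏ k, (S.outcomeProb (z k).1 * S.condProb (z k).1 (z k).2) ≤ η)
    (hproj : ∑ x : Fin l → Fin d with τ * ∏ k, S.eigenvalue (x k) < 1,
      ∏ k, S.eigenvalue (x k) ≤ η) :
    IsTruncation S.seqProb S.ensemble (S.cutoff t) (S.typicalProj l τ) t τ η where
  weight_nonneg := S.seqProb_nonneg
  sum_weight := S.sum_seqProb
  trace_sum := S.trace_sum_ensemble
  posSemidef := S.posSemidef_cutoff t
  posSemidef_sub := S.posSemidef_ensemble_sub_cutoff t
  isStarProjection := isStarProjection_conjDiag_indicator _ _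
  re_trace_sum_sub_le := (S.re_trace_sum_ensemble_sub_cutoff t).trans_le hcut
  re_trace_sum_mul_le := (S.re_trace_sum_ensemble_mul_one_sub_typicalProj τ).trans_le hproj
  hsSq_le _ := S.hsSq_cutoff_le _ ht
  re_trace_le := S.re_trace_typicalProj_le hτ

end Truncation

end MeasuredState

section Rate

open Filter Topology

variable {d m l : ℕ}

lemma IsTruncation.one_le_mul {ι n : Type*} [Fintype ι] [Fintype n] [DecidableEq n] {P : ι → ℝ}
    {T G : ι → Matrix n n ℂ} {Q : Matrix n n ℂ} {t τ η : ℝ} (h : IsTruncation P T G Q t τ η)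
    (hτ : 0 ≤ τ) (ht : 0 ≤ t) {y r : ℝ} (hy : 0 < y) (hy1 : 5 * y ≤ 1) (hη : η ≤ y ^ 2)
    (hr : 1 ≤ r * y ^ 2) : 1 ≤ τ * t * r := by
  have hsη : √η ≤ y := Real.sqrt_le_iff.mpr ⟨hy.le, hη⟩
  have hτt : 2 / 5 ≤ √τ * √t := by nlinarith [h.one_le]
  have hr25 : 25 ≤ r := by
    by_contra! hlt
    nlinarith [mul_lt_mul_of_pos_right hlt (pow_pos hy 2)]
  calc 1 ≤ (2 / 5 : ℝ) ^ 2 * 25 := by norm_num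
    _ ≤ (√τ * √t) ^ 2 * r := by gcongr
    _ = τ * t * r := by rw [mul_pow, Real.sq_sqrt hτ, Real.sq_sqrt ht]

lemma sqrt_mul_sqrt_div_natCeil_le {τ t n r y : ℝ} (hτ : 0 ≤ τ) (ht : 0 ≤ t) (hy : 0 ≤ y)
    (hr : n ≤ r * y ^ 2) : √τ * √(n * t / ⌈τ * t * r⌉₊) ≤ y := by
  rw [← Real.sqrt_mul hτ]
  refine Real.sqrt_le_iff.mpr ⟨hy, ?_⟩
  rw [← mul_div_assoc]
  refine div_le_of_le_mul₀ (Nat.cast_nonneg _) (sq_nonneg y) ?_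
  calc τ * (n * t) ≤ τ * (r * y ^ 2 * t) := by gcongr
    _ = y ^ 2 * (τ * t * r) := by ring
    _ ≤ y ^ 2 * ⌈τ * t * r⌉₊ := by
      gcongr
      exact Nat.le_ceil _

lemma three_mul_sqrt_add_le {y : ℝ} (hy : 0 ≤ y) (hy1 : 5 * y ≤ 1) :
    3 * √(5 * y) + 5 * y ≤ 12 * √y := by
  have hs5 : √5 ≤ 7 / 3 := by
    rw [Real.sqrt_le_left (by norm_num)]
    norm_num
  have hyy : y ≤ √y := Real.le_sqrt_of_sq_le (by nlinarith)
  rw [Real.sqrt_mul (by norm_num)]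
  nlinarith [Real.sqrt_nonneg y]

lemma IsTruncation.exists_isPOVM_card_le {w : Matrix (Fin d) (Fin d) ℂ} (hw : w.PosDef)
    (hw1 : (w * w).trace = 1) {a : Fin m → Matrix (Fin d) (Fin d) ℂ} (ha : IsPOVM a)
    {P : (Fin l → Fin m) → ℝ} {G : (Fin l → Fin m) → Matrix (Fin l → Fin d) (Fin l → Fin d) ℂ}
    {Q : Matrix (Fin l → Fin d) (Fin l → Fin d) ℂ} {t τ η : ℝ}
    (h : IsTruncation P (fun J => tensorProd (fun _ => w) * (tensorProd fun k => a (J k)) *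
      tensorProd fun _ => w) G Q t τ η) (hτ : 0 ≤ τ) (ht : 0 ≤ t) (ν : ℕ) {y r : ℝ}
    (hy : 0 < y) (hy1 : 5 * y ≤ 1) (hη : η ≤ y ^ 2)
    (hr : Fintype.card (MarginalIndex l m ν) ≤ r * y ^ 2) :
    ∃ (M : ℕ) (J : Fin M → Fin l → Fin m)
      (A : Fin M → Matrix (Fin l → Fin d) (Fin l → Fin d) ℂ),
      IsPOVM A ∧ (M : ℝ) ≤ 2 * (τ * t * r) ∧ restrictionError (w * w) a ν J A ≤
        Fintype.card (MarginalIndex l m ν) * (max 1 (‖w⁻¹‖ ^ 2) ^ ν * (12 * √y)) := by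
  have hcard : (1 : ℝ) ≤ Fintype.card (MarginalIndex l m ν) := Nat.one_le_cast.mpr Fintype.card_pos
  have hx : 1 ≤ τ * t * r := h.one_le_mul hτ ht hy hy1 hη (hcard.trans hr)
  have hsη : √η ≤ y := Real.sqrt_le_iff.mpr ⟨hy.le, hη⟩
  have he : √τ * √(Fintype.card (MarginalIndex l m ν) * t / ⌈τ * t * r⌉₊) + (2 * √η + η) <
      5 * y := by
    nlinarith [sqrt_mul_sqrt_div_natCeil_le hτ ht hy.le hr]
  obtain ⟨J, A, hA, hAe⟩ :=
    h.exists_restrictionError_le hw hw1 ha ν (Nat.ceil_pos.mpr (by linarith)) he hy1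
  refine ⟨_, J, A, hA, by linarith [Nat.ceil_lt_add_one (by linarith : 0 ≤ τ * t * r)],
    hAe.trans ?_⟩
  gcongr
  exact three_mul_sqrt_add_le hy.le hy1

lemma eventually_exp_neg_mul_le {c b : ℝ} (hc : 0 < c) (hb : 0 < b) :
    ∀ᶠ l : ℕ in atTop, Real.exp (-c * l) ≤ b := by
  have hlim := Real.tendsto_exp_neg_atTop_nhds_zero.comp
    (tendsto_natCast_atTop_atTop (R := ℝ).const_mul_atTop hc)
  filter_upwards [hlim.eventually_le_const hb] with l hl
  rwa [neg_mul]

lemma eventually_card_marginalIndex_mul_sqrt_exp_le {ν : ℕ → ℕ}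
    (hν : Asymptotics.IsLittleO atTop (fun l : ℕ => (ν l : ℝ)) (fun l : ℕ => (l : ℝ)))
    (m : ℕ) {B c ε : ℝ} (hB : 0 ≤ B) (hc : 0 < c) (hε : 0 < ε) :
    ∀ᶠ l : ℕ in atTop, (Fintype.card (MarginalIndex l m (ν l)) : ℝ) *
      (B ^ ν l * (12 * √(Real.exp (-c * l)))) ≤ ε := by
  filter_upwards [eventually_card_marginalIndex_mul_pow_le hν m hB (show 0 < c / 4 by positivity),
    eventually_exp_neg_mul_le (show 0 < c / 4 by positivity) (show 0 < ε / 12 by positivity)]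
    with l hcard hexp
  calc _ = Fintype.card (MarginalIndex l m (ν l)) * B ^ ν l * (12 * √(Real.exp (-c * l))) := by
        rw [mul_assoc]
    _ ≤ Real.exp (c / 4 * l) * (12 * Real.exp (-c * l / 2)) := by
        rw [← Real.exp_half]
        gcongr
    _ = 12 * Real.exp (-(c / 4) * l) := by
        rw [mul_left_comm, ← Real.exp_add]
        ring_nf
    _ ≤ ε := by linarith

end Rate

namespace MeasuredState

open Filter Topology

variable {d m : ℕ} (S : MeasuredState d m)

lemma exists_sum_eigenvalue_lt_le {δ : ℝ} (hδ : 0 < δ) : ∃ κ > 0, ∀ l : ℕ,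
    ∑ x : Fin l → Fin d with Real.exp (l * (S.stateEntropy + δ)) * ∏ k, S.eigenvalue (x k) < 1,
      ∏ k, S.eigenvalue (x k) ≤ Real.exp (-κ * l) := by
  have hmean : ∑ i, S.eigenvalue i * -Real.log (S.eigenvalue i) < S.stateEntropy + δ := by
    simpa only [stateEntropy, Real.negMulLog, mul_neg, neg_mul] using lt_add_of_pos_right _ hδ
  obtain ⟨κ, hκ, hle⟩ := exists_large_deviation_bound (fun i => (S.eigenvalue_pos i).le)
    S.sum_eigenvalue hmean
  refine ⟨κ, hκ, fun l => le_trans ?_ (hle l)⟩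
  refine Finset.sum_le_sum_of_subset_of_nonneg (Finset.monotone_filter_right _ fun x _ hx => ?_)
    fun x _ _ => Finset.prod_nonneg fun k _ => (S.eigenvalue_pos _).le
  have hpos : 0 < ∏ k, S.eigenvalue (x k) := Finset.prod_pos fun k _ => S.eigenvalue_pos _
  have hlog := Real.log_neg (mul_pos (Real.exp_pos _) hpos) hx
  rw [Real.log_mul (Real.exp_pos _).ne' hpos.ne', Real.log_exp,
    Real.log_prod fun k _ => (S.eigenvalue_pos _).ne'] at hlog
  rw [Finset.sum_neg_distrib]
  linarith

lemma sum_outcomeProb_mul_condProb :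
    ∑ z : Fin m × Fin d, S.outcomeProb z.1 * S.condProb z.1 z.2 = 1 := by
  simp only [Fintype.sum_prod_type, ← Finset.mul_sum, outcomeProb_mul_sum_condProb,
    sum_outcomeProb]

lemma sum_outcomeProb_mul_condProb_mul_log :
    ∑ z : Fin m × Fin d, S.outcomeProb z.1 * S.condProb z.1 z.2 * Real.log (S.condProb z.1 z.2) =
      -S.meanEntropy := by
  simp only [Fintype.sum_prod_type, meanEntropy, Real.negMulLog, mul_assoc, ← Finset.mul_sum,
    neg_mul, Finset.sum_neg_distrib, mul_neg, neg_neg]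

lemma exists_sum_lt_condProb_le {δ : ℝ} (hδ : 0 < δ) : ∃ κ > 0, ∀ l : ℕ,
    ∑ z : Fin l → Fin m × Fin d with
        Real.exp (l * (-S.meanEntropy + δ)) < ∏ k, S.condProb (z k).1 (z k).2,
      ∏ k, (S.outcomeProb (z k).1 * S.condProb (z k).1 (z k).2) ≤ Real.exp (-κ * l) := by
  have hnonneg (z : Fin m × Fin d) : 0 ≤ S.outcomeProb z.1 * S.condProb z.1 z.2 :=
    mul_nonneg (S.outcomeProb_nonneg _) (S.condProb_nonneg _ _)
  obtain ⟨κ, hκ, hle⟩ := exists_large_deviation_bound hnonneg S.sum_outcomeProb_mul_condProb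
    (S.sum_outcomeProb_mul_condProb_mul_log.trans_lt (lt_add_of_pos_right _ hδ))
  refine ⟨κ, hκ, fun l => le_trans ?_ (hle l)⟩
  refine Finset.sum_le_sum_of_subset_of_nonneg (Finset.monotone_filter_right _ fun z _ hz => ?_)
    fun z _ _ => Finset.prod_nonneg fun k _ => hnonneg _
  have hpos := (Real.exp_pos _).trans hz
  rw [← Real.log_prod fun k _ => Finset.prod_ne_zero_iff.mp hpos.ne' k (Finset.mem_univ k)]
  exact (Real.le_log_iff_exp_le hpos).mpr hz.le

lemma exists_isTruncation {δ : ℝ} (hδ : 0 < δ) : ∃ κ > 0, ∀ l : ℕ,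
    IsTruncation S.seqProb S.ensemble (S.cutoff (Real.exp (l * (-S.meanEntropy + δ))))
      (S.typicalProj l (Real.exp (l * (S.stateEntropy + δ))))
      (Real.exp (l * (-S.meanEntropy + δ))) (Real.exp (l * (S.stateEntropy + δ)))
      (Real.exp (-κ * l)) := by
  obtain ⟨κ₁, hκ₁, hproj⟩ := S.exists_sum_eigenvalue_lt_le hδ
  obtain ⟨κ₂, hκ₂, hcut⟩ := S.exists_sum_lt_condProb_le hδ
  refine ⟨min κ₁ κ₂, lt_min hκ₁ hκ₂, fun l =>
    S.isTruncation (Real.exp_pos _).le (Real.exp_pos _).le ((hcut l).trans ?_)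
      ((hproj l).trans ?_)⟩
  all_goals gcongr
  exacts [min_le_right _ _, min_le_left _ _]

lemma eventually_exists_isPOVM_le_exp {ν : ℕ → ℕ}
    (hν : Asymptotics.IsLittleO atTop (fun l : ℕ => (ν l : ℝ)) (fun l : ℕ => (l : ℝ)))
    {ε : ℝ} (hε : 0 < ε) {δ : ℝ} (hδ : 0 < δ) :
    ∀ᶠ l : ℕ in atTop, ∃ (M : ℕ) (J : Fin M → Fin l → Fin m)
      (A : Fin M → Matrix (Fin l → Fin d) (Fin l → Fin d) ℂ), IsPOVM A ∧
      (M : ℝ) ≤ Real.exp (l * (S.stateEntropy - S.meanEntropy + 5 * δ)) ∧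
      restrictionError S.state S.povm (ν l) J A ≤ ε := by
  obtain ⟨κ, hκ, htrunc⟩ := S.exists_isTruncation hδ
  obtain ⟨c, hc, hcδ, hcκ⟩ : ∃ c > 0, 2 * c ≤ δ ∧ 2 * c ≤ κ :=
    ⟨min δ κ / 2, by positivity, by linarith [min_le_left δ κ], by linarith [min_le_right δ κ]⟩
  filter_upwards [eventually_exp_neg_mul_le hc (show (0 : ℝ) < 1 / 5 by norm_num),
    eventually_exp_neg_mul_le hδ (show (0 : ℝ) < 1 / 2 by norm_num),
    eventually_card_marginalIndex_mul_pow_le hν m zero_le_one hδ,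
    eventually_card_marginalIndex_mul_sqrt_exp_le hν m (B := max 1 (‖S.sqrtState⁻¹‖ ^ 2))
      (by positivity) hc hε] with l hy1 hδ2 hcard hcardε
  have hη : Real.exp (-κ * l) ≤ Real.exp (-c * l) ^ 2 := by
    rw [← Real.exp_nat_mul]
    exact Real.exp_le_exp.mpr (by push_cast; nlinarith [Nat.cast_nonneg (α := ℝ) l])
  have hr : (Fintype.card (MarginalIndex l m (ν l)) : ℝ) ≤
      Real.exp ((δ + 2 * c) * l) * Real.exp (-c * l) ^ 2 := by
    rw [one_pow, mul_one] at hcard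
    refine hcard.trans_eq ?_
    rw [← Real.exp_nat_mul, ← Real.exp_add]
    congr 1
    push_cast
    ring
  obtain ⟨M, J, A, hA, hM, hAe⟩ := (htrunc l).exists_isPOVM_card_le S.posDef_sqrtState
    (by rw [sqrtState_mul_self, S.trace_eq_one]) S.isPOVM (Real.exp_pos _).le (Real.exp_pos _).le
    (ν l) (Real.exp_pos _) (by linarith) hη hr
  rw [sqrtState_mul_self] at hAe
  refine ⟨M, J, A, hA, hM.trans ?_, hAe.trans hcardε⟩
  have h2 : 2 ≤ Real.exp (δ * l) := by
    rw [neg_mul, Real.exp_neg] at hδ2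
    simpa using (inv_le_comm₀ (Real.exp_pos _) (by norm_num)).mp hδ2
  calc _ ≤ Real.exp (δ * l) * (Real.exp (l * (S.stateEntropy + δ)) *
        Real.exp (l * (-S.meanEntropy + δ)) * Real.exp ((δ + 2 * c) * l)) := by gcongr
    _ ≤ _ := by
      simp only [← Real.exp_add]
      exact Real.exp_le_exp.mpr (by nlinarith [Nat.cast_nonneg (α := ℝ) l])

lemma eventually_exists_isPOVM {ν : ℕ → ℕ}
    (hν : Asymptotics.IsLittleO atTop (fun l : ℕ => (ν l : ℝ)) (fun l : ℕ => (l : ℝ)))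
    {ε : ℝ} (hε : 0 < ε) {δ : ℝ} (hδ : 0 < δ) :
    ∀ᶠ l : ℕ in atTop, ∃ (M : ℕ) (J : Fin M → Fin l → Fin m)
      (A : Fin M → Matrix (Fin l → Fin d) (Fin l → Fin d) ℂ), IsPOVM A ∧
      (M : ℝ) ≤ 2 ^ (l * (entropyDefect S.state S.povm + δ)) ∧
      restrictionError S.state S.povm (ν l) J A ≤ ε := by
  filter_upwards [S.eventually_exists_isPOVM_le_exp hν hε
    (show 0 < δ * Real.log 2 / 5 by positivity)] with l ⟨M, J, A, hA, hM, hAε⟩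
  refine ⟨M, J, A, hA, hM.trans_eq ?_, hAε⟩
  rw [Real.rpow_def_of_pos two_pos, entropyDefect_eq]
  congr 1
  field_simp

end MeasuredState

open Filter in
lemma exists_isLittleO_forall_le_rpow {g : ℕ → ℝ} {R : ℝ}
    (h : ∀ δ > 0, ∀ᶠ l : ℕ in atTop, g l ≤ 2 ^ (l * (R + δ))) :
    ∃ f : ℕ → ℝ, Asymptotics.IsLittleO atTop f (fun l : ℕ => (l : ℝ)) ∧
      ∀ l : ℕ, g l ≤ 2 ^ (l * R + f l) := by
  have hmax (l : ℕ) : 0 < max (g l) (2 ^ (l * R)) := lt_max_of_lt_right (by positivity)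
  refine ⟨fun l => Real.logb 2 (max (g l) (2 ^ (l * R))) - l * R, ?_, fun l => ?_⟩
  · refine Asymptotics.isLittleO_iff.mpr fun δ hδ => ?_
    filter_upwards [h δ hδ] with l hl
    have hle : max (g l) (2 ^ (l * R)) ≤ 2 ^ (l * (R + δ)) :=
      max_le hl (Real.rpow_le_rpow_of_exponent_le one_le_two (by gcongr; linarith))
    rw [Real.norm_natCast, Real.norm_of_nonneg]
    · linarith [(Real.logb_le_iff_le_rpow one_lt_two (hmax l)).mpr hle]
    · exact sub_nonneg.mpr ((Real.le_logb_iff_rpow_le one_lt_two (hmax l)).mpr (le_max_right _ _))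
  · rw [add_sub_cancel, Real.rpow_logb two_pos (by norm_num) (hmax l)]
    exact le_max_left _ _

end QMeas

end

theorem theorem4 {d m : ℕ}
    (ρ : Matrix (Fin d) (Fin d) ℂ) (hρ : ρ.PosDef) (hρ1 : ρ.trace = 1)
    (a : Fin m → Matrix (Fin d) (Fin d) ℂ) (ha : QMeas.IsPOVM a)
    (ν : ℕ → ℕ)
    (hν : Asymptotics.IsLittleO Filter.atTop (fun l : ℕ => (ν l : ℝ)) (fun l : ℕ => (l : ℝ)))
    (ε : ℝ) (hε : 0 < ε) :
    ∃ f : ℕ → ℝ, Asymptotics.IsLittleO Filter.atTop f (fun l : ℕ => (l : ℝ)) ∧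
      ∀ l : ℕ, ∃ (M : ℕ) (J : Fin M → Fin l → Fin m)
        (A : Fin M → Matrix (Fin l → Fin d) (Fin l → Fin d) ℂ),
        QMeas.IsPOVM A ∧
        (M : ℝ) ≤ (2 : ℝ) ^ ((l : ℝ) * QMeas.entropyDefect ρ a + f l) ∧
        QMeas.restrictionError ρ a (ν l) J A ≤ ε := by
  classical
  let S : QMeas.MeasuredState d m := ⟨ρ, a, hρ, hρ1, ha⟩
  have hgood (l : ℕ) : ∃ (M : ℕ) (J : Fin M → Fin l → Fin m)
      (A : Fin M → Matrix (Fin l → Fin d) (Fin l → Fin d) ℂ),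
      QMeas.IsPOVM A ∧ QMeas.restrictionError ρ a (ν l) J A ≤ ε := by
    obtain ⟨M, J, A, hA, hA0⟩ := QMeas.exists_isPOVM_restrictionError_eq_zero hρ1 ha l (ν l)
    exact ⟨M, J, A, hA, hA0.trans_le hε.le⟩
  have hrate : ∀ δ > 0, ∀ᶠ l : ℕ in Filter.atTop,
      (Nat.find (hgood l) : ℝ) ≤ 2 ^ (l * (QMeas.entropyDefect ρ a + δ)) := fun δ hδ => by
    filter_upwards [S.eventually_exists_isPOVM hν hε hδ] with l ⟨M, J, A, hA, hM, hAε⟩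
    exact (Nat.cast_le.mpr (Nat.find_min' (hgood l) ⟨J, A, hA, hAε⟩)).trans hM
  obtain ⟨f, hf, hfle⟩ := QMeas.exists_isLittleO_forall_le_rpow hrate
  refine ⟨f, hf, fun l => ?_⟩
  obtain ⟨J, A, hA, hAε⟩ := Nat.find_spec (hgood l)
  exact ⟨_, J, A, hA, hfle l, hAε⟩
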